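/- **Setting.** Let $p$ be a prime and $K_0$ a $p$-adic field (complete, discretely valued, of characteristic $0$ and residue characteristic $p$), with completed algebraic closure $\hat{\overline{K_0}}$. Let $\Delta$ be a finite non-empty set and, for $\alpha\in\Delta$, let $K_\alpha$ be a perfectoid field with $K_0\subset K_\alpha\subset\hat{\overline{K_0}}$. Let $\mathcal O_{K,\Delta}$ be the $p$-adically completed tensor product over $\mathcal O_{K_0}$ of the rings of integers $\mathcal O_{K_\alpha}$. An embedding family is a family $s=(s_\alpha)_{\alpha\in\Delta}$ of continuous $K_0$-embeddings $s_\alpha:K_\alpha\to\hat{\overline{K_0}}$; $K_s$ is the completion of the compositum of the $s_\alpha(K_\alpha)$; $s\sim s'$ if there is a topological isomorphism $u:K_s\to K_{s'}$ with $u\circ s_\alpha=s'_\alpha$ for all $\alpha$; and $\mathfrak S$ is the set of equivalence classes. Each $s$ gives $\beta_s:\mathcal O_{K,\Delta}\to\mathcal O_{K_s}$, $\bigotimes x_\alpha\mapsto\prod s_\alpha(x_\alpha)$. Let $A=\varprojlim_{x\mapsto x^p}\mathcal O_{K,\Delta}/p$ be the tilt, $\beta_s^\flat: A\to\varprojlim_{x\mapsto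 x^p}\mathcal O_{K_s}/p$ the map induced by $\beta_s$, $|x|_s=|\beta_s^\flat(x)^\sharp|$, $|x|=\sup_{s\in\mathfrak S}|x|_s$ and $\mathfrak h=\{x\in A:|x|<1\}$. Let $\varpi\in A$ be a pseudo-uniformizer: a non-zero-divisor such that $|\varpi|_s$ is independent of $s\in\mathfrak S$ and lies in $(0,1)$. The perfectoid $\Delta$-field $K_\Delta$ of characteristic $p$ is the total ring of fractions of $A$, or $A[1/\varpi]$, or more generally any localization of $A$ at a multiplicative set of non-zero-divisors containing $\varpi$. **Banach and perfectoid algebras.** A Banach $K_\Delta$-algebra is a commutative $K_\Delta$-algebra $R$ with maps $\|\cdot\|_s:R\to\mathbb R_{\ge0}$ ($s\in\mathfrak S$) such that $\|x+y\|_s\le\max(\|x\|_s,\|y\|_s)$; $\|xy\|_s\le\|x\|_s\|y\|_s$; $|b|_s\|\lambda x\|_s=|a|_s\|x\|_s$ for $a,b\in A$ and $\lambda\in K_\Delta$ with $b\lambda=a$; $\|1\|_s=1$ unless $\|\cdot\|_s$ is identically $0$; $\|x\|:=\sup_s\|x\|_s$ is finite; $x=0$ if $\|x\|_s=0$ for all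 $s$; and $R$ is complete for $\|\cdot\|$. It carries the topology defined by $\|\cdot\|$. Let $R^\circ$ be the ring of elements $x$ whose powers $x^n$ are bounded in norm. $R$ is perfectoid if $R^\circ$ is open and bounded in $R$ and the Frobenius $R^\circ/\varpi\to R^\circ/\varpi$ is surjective. **Almost algebra** is taken with respect to $\mathfrak h\subset A$; a module is almost zero if $\mathfrak h$ kills it. Let $B$ be an $A$-algebra and $N$ a $B$-module. $N^a$ is flat (resp. almost projective) over $B^a$ if $N\otimes_B-$ (resp. $\mathrm{Hom}_B(N,-)$) is exact up to almost zero modules; it is almost finitely generated (resp. presented) if for every $\epsilon\in\mathfrak h$ there is a map $N_\epsilon\to N$, with $N_\epsilon$ a finitely generated (resp. presented) $B$-module, whose kernel and cokernel are killed by $\epsilon$; uniformly almost finitely generated if moreover $N_\epsilon$ can be generated by $n$ elements, with $n$ independent of $\epsilon$. $N^a$ is uniformly finite projective if it is flat, almost finitely presented, almost projective and uniformly almost finitely generated. For a $B$-algebra $C$ with multiplication $\mu:C\otimes_BC\to C$, $C^a$ is finite étale over $B^a$ if it is flat and almost finitely presented over $B^a$ and unramified: writing $M_*=\mathrm{Hom}_A(\mathfrak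 h,M)$, there is $e\in(C\otimes_BC)_*$ with $e^2=e$, $\mu(e)=1$, and $xe=0$ for all $x\in\ker(\mu)_*$. **Proposition (almost purity in characteristic $p$).** Let $K_\Delta$ be a perfectoid $\Delta$-field of characteristic $p$, $R$ a perfectoid $K_\Delta$-algebra and $R\to S$ a finite étale ring homomorphism. Then there are norms $\|\cdot\|_s$ on $S$ that make it a Banach $K_\Delta$-algebra whose topology is the canonical topology of the finite $R$-module $S$ (the finest topology making $S$ a topological $R$-module); if $R\to S$ is injective and $\|1\|_s=1$ for all $s$ in $R$, they can moreover be chosen with $\|1\|_s=1$ for all $s$ in $S$. With this structure $S$ is perfectoid, $R\to S$ maps $R^\circ$ into $S^\circ$, $S^{\circ a}$ is finite étale over $R^{\circ a}$, and $S^{\circ a}$ is a uniformly finite projective $R^{\circ a}$-module. -/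

import Mathlib

open scoped NNReal TensorProduct

universe v

noncomputable section

namespace DeltaPerfectoid

/-- The ring of integers `{x | ‖x‖ ≤ 1}` of a non-archimedean normed field. -/
abbrev IntegerRing (F : Type*) [NormedField F] [IsUltrametricDist F] : Subring F :=
  (NormedField.valuation (K := F)).integer

/-- A complete non-archimedean field `K₀` is a `p`-adic field if it is discretely valued, of
characteristic `0` and of residue characteristic `p`. -/
class IsPAdicField (p : ℕ) (K₀ : Type*) [NontriviallyNormedField K₀] [IsUltrametricDist K₀]
    [CompleteSpace K₀] : Prop where
  charZero : CharZero K₀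
  norm_p_lt_one : ‖(p : K₀)‖ < 1
  discrete : IsDiscreteValuationRing (IntegerRing K₀)

section CompletedClosure

variable (K₀ : Type*) [NontriviallyNormedField K₀] [IsUltrametricDist K₀] [CompleteSpace K₀]

/-- The algebraic closure of `K₀`, normed by the unique extension of the norm of `K₀`. -/
def NormedAlgClosure : Type _ := AlgebraicClosure K₀

instance : NormedField (NormedAlgClosure K₀) :=
  spectralNorm.normedField K₀ (AlgebraicClosure K₀)

instance : NormedAlgebra K₀ (NormedAlgClosure K₀) :=
  spectralNorm.normedAlgebra K₀ (AlgebraicClosure K₀)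

/-- The completion of the algebraic closure of `K₀`. -/
abbrev CompletedClosure : Type _ := UniformSpace.Completion (NormedAlgClosure K₀)

instance : IsUltrametricDist (CompletedClosure K₀) := IsUltrametricDist.of_normedAlgebra K₀

end CompletedClosure

/-- A perfectoid field (of residue characteristic `p`): a complete non-archimedean field whose
valuation is not discrete, with surjective Frobenius on `𝒪 / p`. -/
structure IsPerfectoidField (p : ℕ) (F : Type*) [NormedField F] [IsUltrametricDist F] : Prop where
  complete : CompleteSpace F
  norm_p_lt_one : ‖(p : F)‖ < 1
  nondiscrete : ∀ r : ℝ, r < 1 → ∃ x : F, r < ‖x‖ ∧ ‖x‖ < 1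
  frobenius : ∀ x : IntegerRing F, ∃ y : IntegerRing F, (p : IntegerRing F) ∣ x - y ^ p

/-- The map on rings of integers induced by an extension of non-archimedean fields. -/
instance (E F : Type*) [NormedField E] [IsUltrametricDist E] [NormedField F] [IsUltrametricDist F]
    [NormedAlgebra E F] : Algebra (IntegerRing E) (IntegerRing F) :=
  RingHom.toAlgebra <|
    ((algebraMap E F).comp (IntegerRing E).subtype).codRestrict (IntegerRing F) fun x => by
      have h : ‖algebraMap E F (x : E)‖ ≤ 1 := by
        rw [norm_algebraMap']; exact x.2
      exact h

/-- A continuous embedding over `K₀` does not leave the closed unit ball. -/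
theorem norm_map_le_one {K₀ E F : Type*} [NontriviallyNormedField K₀] [NormedField E]
    [NormedField F] [NormedAlgebra K₀ E] [NormedAlgebra K₀ F] (f : E →ₐ[K₀] F)
    (hf : Continuous f) {x : E} (hx : ‖x‖ ≤ 1) : ‖f x‖ ≤ 1 := by
  have key : ∀ y : E, ‖y‖ < 1 → ‖f y‖ < 1 := fun y hy => by
    have h1 := tendsto_pow_atTop_nhds_zero_of_norm_lt_one hy
    have h2 := (hf.tendsto 0).comp h1
    rw [map_zero] at h2
    have h3 := (h2.norm).eventually (gt_mem_nhds (by simp : ‖(0 : F)‖ < 1))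
    obtain ⟨n, hn⟩ := h3.exists
    simp only [Function.comp_apply, map_pow, norm_pow] at hn
    by_contra hcon
    exact absurd (one_le_pow₀ (not_lt.mp hcon)) (not_le.mpr hn)
  by_contra hcon
  rw [not_le] at hcon
  obtain ⟨c, hc0, hc1⟩ := NormedField.exists_norm_lt_one K₀
  have h : ∀ n : ℕ, ‖f x‖ ^ n * ‖c‖ < 1 := fun n => by
    have := key (x ^ n * algebraMap K₀ E c) (by
      rw [norm_mul, norm_pow, norm_algebraMap']
      exact lt_of_le_of_lt (mul_le_of_le_one_left (norm_nonneg _) (pow_le_one₀ (norm_nonneg _) hx))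
        hc1)
    simpa [norm_algebraMap'] using this
  obtain ⟨n, hn⟩ := pow_unbounded_of_one_lt (‖c‖⁻¹) hcon
  have := h n
  rw [inv_lt_iff_one_lt_mul₀ hc0] at hn
  linarith [mul_comm (‖c‖) (‖f x‖ ^ n)]

/-- The map on rings of integers induced by a continuous embedding over `K₀`. -/
def integerMap {K₀ E F : Type*} [NontriviallyNormedField K₀] [IsUltrametricDist K₀]
    [NormedField E] [IsUltrametricDist E] [NormedField F] [IsUltrametricDist F]
    [NormedAlgebra K₀ E] [NormedAlgebra K₀ F] (f : E →ₐ[K₀] F)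
    (hf : Continuous f) : IntegerRing E →ₐ[IntegerRing K₀] IntegerRing F where
  __ := ((f : E →+* F).comp (IntegerRing E).subtype).codRestrict (IntegerRing F)
    fun x => norm_map_le_one f hf x.2
  commutes' r := Subtype.ext (f.commutes (r : K₀))

theorem norm_natCast_eq (K₀ C : Type*) [NontriviallyNormedField K₀] [NormedField C]
    [NormedAlgebra K₀ C] (n : ℕ) : ‖(n : C)‖ = ‖(n : K₀)‖ := by
  rw [← map_natCast (algebraMap K₀ C), norm_algebraMap']

theorem mem_span_pow_iff {p : ℕ} [hp : Fact p.Prime] (K₀ : Type*) {C : Type*}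
    [NontriviallyNormedField K₀] [IsUltrametricDist K₀] [CompleteSpace K₀] [IsPAdicField p K₀]
    [NormedField C] [IsUltrametricDist C] [NormedAlgebra K₀ C] (n : ℕ) (x : IntegerRing C) :
    x ∈ Ideal.span {(p : IntegerRing C)} ^ n ↔
      ‖(x : C)‖ ≤ ‖(p : K₀)‖ ^ n := by
  have := IsPAdicField.charZero p (K₀ := K₀)
  have hp0 : (p : C) ≠ 0 := by
    rw [← norm_ne_zero_iff, norm_natCast_eq K₀ C, norm_ne_zero_iff]
    exact_mod_cast hp.1.ne_zero
  rw [Ideal.span_singleton_pow, Ideal.mem_span_singleton,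
    ← norm_natCast_eq K₀ C p, ← norm_pow]
  constructor
  · rintro ⟨y, rfl⟩
    have hy : ‖(y : C)‖ ≤ 1 := y.2
    have : (((p : IntegerRing C) ^ n * y : IntegerRing C) :
      C) = (p : C) ^ n * y := by push_cast; rfl
    rw [this, norm_mul]
    exact mul_le_of_le_one_right (norm_nonneg _) hy
  · intro h
    refine ⟨⟨(x : C) / (p : C) ^ n, ?_⟩, ?_⟩
    · have : ‖(x : C) / (p : C) ^ n‖ ≤ 1 := by
        rw [norm_div]
        exact div_le_one_of_le₀ h (norm_nonneg _)
      exact this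
    · apply Subtype.ext
      push_cast
      rw [mul_div_cancel₀]
      exact pow_ne_zero _ hp0

theorem isAdicComplete_integerRing (p : ℕ) [hp : Fact p.Prime] (K₀ C : Type*)
    [NontriviallyNormedField K₀] [IsUltrametricDist K₀] [CompleteSpace K₀] [IsPAdicField p K₀]
    [NormedField C] [IsUltrametricDist C] [NormedAlgebra K₀ C] [CompleteSpace C] :
    IsAdicComplete (Ideal.span {(p : IntegerRing C)})
      (IntegerRing C) := by
  have := IsPAdicField.charZero p (K₀ := K₀)
  have hp0 : 0 < ‖(p : K₀)‖ := norm_pos_iff.mpr (by exact_mod_cast hp.1.ne_zero)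
  have h : IsAdic (Ideal.span {(p : IntegerRing C)}) := by
    rw [isAdic_iff]
    refine ⟨fun n => ?_, fun s hs => ?_⟩
    · refine AddSubgroup.isOpen_of_mem_nhds
        (Ideal.span {(p : IntegerRing C)} ^ n).toAddSubgroup (g := 0) ?_
      refine Filter.mem_of_superset (Metric.ball_mem_nhds 0 (pow_pos hp0 n)) fun x hx => ?_
      refine (mem_span_pow_iff K₀ n x).mpr ?_
      rw [mem_ball_zero_iff] at hx
      exact hx.le
    · obtain ⟨ε, hε, hs⟩ := Metric.mem_nhds_iff.mp hs
      obtain ⟨n, hn⟩ := exists_pow_lt_of_lt_one hε (IsPAdicField.norm_p_lt_one (p := p) (K₀ := K₀))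
      refine ⟨n, fun x hx => hs ?_⟩
      rw [mem_ball_zero_iff]
      exact lt_of_le_of_lt ((mem_span_pow_iff K₀ n x).mp hx) hn
  rw [h.isAdicComplete_iff]
  refine ⟨?_, inferInstance⟩
  have hcl : IsClosed {x : C | ‖x‖ ≤ 1} :=
    isClosed_le continuous_norm continuous_const
  exact hcl.completeSpace_coe

/-- The tensor product over `R` of a family of commutative `R`-algebras. -/
def TensorRing {ι : Type*} (R : Type*) (A : ι → Type*) [CommRing R] [∀ i, CommRing (A i)]
    [∀ i, Algebra R (A i)] : Type _ := ⨂[R] i, A i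

instance {ι : Type*} (R : Type*) (A : ι → Type*) [CommRing R] [∀ i, CommRing (A i)]
    [∀ i, Algebra R (A i)] : CommRing (TensorRing R A) :=
  inferInstanceAs (CommRing (⨂[R] i, A i))

/-- The `p`-adic completion of a ring. -/
def PAdicCompletion (p : ℕ) (A : Type*) [CommRing A] : Type _ :=
  AdicCompletion (Ideal.span {(p : A)}) A

instance (p : ℕ) (A : Type*) [CommRing A] : CommRing (PAdicCompletion p A) :=
  inferInstanceAs (CommRing (AdicCompletion (Ideal.span {(p : A)}) A))

/-- The ring map `⨂ A i → S`, `⨂ x i ↦ ∏ f i (x i)`. -/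
def piTensorEval {ι R S : Type*} [Fintype ι] {A : ι → Type*} [CommRing R] [CommRing S]
    [Algebra R S] [∀ i, CommRing (A i)] [∀ i, Algebra R (A i)] (f : ∀ i, A i →ₐ[R] S) :
    TensorRing R A →+* S :=
  (PiTensorProduct.liftAlgHom
    ((MultilinearMap.mkPiAlgebra R ι S).compLinearMap fun i => (f i).toLinearMap)
    (by simp) (by intro x y; simp [Finset.prod_mul_distrib])).toRingHom

/-- The reduction mod `p ^ n` of the `p`-adic extension of a ring homomorphism `f : A → B`. -/
def adicExtendMod (p : ℕ) {A B : Type*} [CommRing A] [CommRing B] (f : A →+* B) (n : ℕ) :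
    AdicCompletion (Ideal.span {(p : A)}) A →+* B ⧸ Ideal.span {(p : B)} ^ n :=
  (Ideal.quotientMap (I := Ideal.span {(p : A)} ^ n) (Ideal.span {(p : B)} ^ n) f
      (by rw [← Ideal.map_le_iff_le_comap, Ideal.map_pow, Ideal.map_span]; simp)).comp
    (AdicCompletion.evalₐ (Ideal.span {(p : A)}) n :
      AdicCompletion (Ideal.span {(p : A)}) A →+* A ⧸ Ideal.span {(p : A)} ^ n)

theorem adicExtendMod_mk (p : ℕ) {A B : Type*} [CommRing A] [CommRing B] (f : A →+* B) (n : ℕ)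
    (x : AdicCompletion.AdicCauchySequence (Ideal.span {(p : A)}) A) :
    adicExtendMod p f n (AdicCompletion.mk _ A x) = Ideal.Quotient.mk _ (f (x.val n)) := by
  rw [adicExtendMod, RingHom.comp_apply, RingHom.coe_coe, AdicCompletion.evalₐ_mk,
    Ideal.quotientMap_mk]

/-- The extension of `f : A → B` to the `p`-adic completion of `A`, when `B` is `p`-adically
complete. -/
def adicExtendAux (p : ℕ) {A B : Type*} [CommRing A] [CommRing B]
    [IsAdicComplete (Ideal.span {(p : B)}) B] (f : A →+* B) :
    AdicCompletion (Ideal.span {(p : A)}) A →+* B :=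
  IsAdicComplete.liftRingHom (Ideal.span {(p : B)}) (adicExtendMod p f) (by
    intro m n hmn
    ext x
    induction x using AdicCompletion.induction_on with
    | _ x =>
    rw [RingHom.comp_apply, adicExtendMod_mk, adicExtendMod_mk, Ideal.Quotient.factor_mk]
    have h := congrArg (Ideal.quotientMap (I := Ideal.span {(p : A)} ^ m)
      (Ideal.span {(p : B)} ^ m) f
      (by rw [← Ideal.map_le_iff_le_comap, Ideal.map_pow, Ideal.map_span]; simp))
      (AdicCompletion.Ideal.mk_eq_mk (I := Ideal.span {(p : A)}) hmn x)
    simpa only [Ideal.quotientMap_mk] using h)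

/-- The unique extension of a ring homomorphism `A → B` to the `p`-adic completion of `A`, when `B`
is `p`-adically complete. -/
def adicExtend (p : ℕ) {A B : Type*} [CommRing A] [CommRing B]
    [IsAdicComplete (Ideal.span {(p : B)}) B] (f : A →+* B) :
    PAdicCompletion p A →+* B :=
  adicExtendAux p f

section

variable (p : ℕ)
variable (K₀ : Type*) [NontriviallyNormedField K₀] [IsUltrametricDist K₀] [CompleteSpace K₀]
variable (C : Type*) [NormedField C] [IsUltrametricDist C] [NormedAlgebra K₀ C]
variable (Δ : Type*)

/-- Perfectoid fields `K α`, `α ∈ Δ`, between `K₀` and `C` (to be taken to be the completed algebraic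
closure of `K₀`). -/
structure PerfectoidFamily where
  K : Δ → IntermediateField K₀ C
  perfectoid : ∀ α, IsPerfectoidField p (K α)

namespace PerfectoidFamily

variable {p K₀ C Δ}
variable (D : PerfectoidFamily p K₀ C Δ)

/-- The tensor product of the rings of integers of the `K α` over the ring of integers of `K₀`. -/
abbrev IntegralTensor : Type _ := TensorRing (IntegerRing K₀) fun α => IntegerRing (D.K α)

/-- The completed tensor product `𝒪_{K,Δ}`. The topology of the projective tensor seminorm on
`⨂ 𝒪_{K α}` is the `p`-adic one, so the completion is the `p`-adic completion. -/
abbrev CompletedTensor : Type _ := PAdicCompletion p D.IntegralTensor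

/-- An embedding family: continuous embeddings `s α : K α → C` over `K₀`. -/
abbrev EmbFamily : Type _ :=
  ∀ α, {f : D.K α →ₐ[K₀] C // Continuous f}

/-- The field `K_s`: the completion (i.e. closure) of the compositum of the `s α (K α)`. -/
def compositum (s : D.EmbFamily) : Subfield C :=
  (⨆ α, (s α).1.fieldRange).toSubfield.topologicalClosure

/-- Two embedding families are equivalent if they differ by a topological isomorphism
`u : K_s ≃ K_s'` with `u ∘ s α = s' α` for all `α`. -/
def embSetoid : Setoid D.EmbFamily where
  r s s' := ∃ u : D.compositum s ≃+* D.compositum s', Continuous u ∧ Continuous u.symm ∧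
    ∀ (α : Δ) (x : D.K α) (y : D.compositum s),
      (y : C) = (s α).1 x → (u y : C) = (s' α).1 x
  iseqv :=
    { refl := fun s => ⟨RingEquiv.refl _, continuous_id, continuous_id, fun _ _ _ h => h⟩
      symm := by
        rintro s s' ⟨u, hu, hu', h⟩
        refine ⟨u.symm, hu', hu, fun α x y hy => ?_⟩
        have hx : (s α).1 x ∈ D.compositum s :=
          Subfield.le_topologicalClosure _
            (le_iSup (fun α => (s α).1.fieldRange) α ⟨x, rfl⟩)
        have h1 : y = u ⟨_, hx⟩ := Subtype.ext (hy.trans (h α x ⟨_, hx⟩ rfl).symm)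
        rw [h1, RingEquiv.symm_apply_apply]
      trans := by
        rintro s s' s'' ⟨u, hu, hu', h⟩ ⟨v, hv, hv', h'⟩
        exact ⟨u.trans v, hv.comp hu, hu'.comp hv', fun α x y hy => h' α x _ (h α x y hy)⟩ }

/-- The set `𝔖` of equivalence classes of embedding families. -/
def 𝔖 : Type _ := Quotient D.embSetoid

section beta

variable [Fintype Δ]

/-- The map `⨂ 𝒪_{K α} → 𝒪_C`, `⨂ x α ↦ ∏ s α (x α)`. -/
def tensorEval (s : D.EmbFamily) : D.IntegralTensor →+* IntegerRing C :=
  piTensorEval fun α => integerMap (s α).1 (s α).2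

variable [hp : Fact p.Prime] [IsPAdicField p K₀] [CompleteSpace C]

/-- The ring homomorphism `β_s : 𝒪_{K,Δ} → 𝒪_{K_s} ⊆ 𝒪_C`: the `p`-adically continuous extension
of `⨂ x α ↦ ∏ s α (x α)`. -/
def beta (s : D.EmbFamily) : D.CompletedTensor →+* IntegerRing C :=
  haveI := isAdicComplete_integerRing p K₀ C
  adicExtend p (D.tensorEval s)

theorem norm_p_lt_one (p : ℕ) (K₀ C : Type*) [NontriviallyNormedField K₀] [IsUltrametricDist K₀]
    [CompleteSpace K₀] [IsPAdicField p K₀] [NormedField C] [NormedAlgebra K₀ C] :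
    ‖(p : C)‖ < 1 := by
  rw [norm_natCast_eq K₀ C]
  exact IsPAdicField.norm_p_lt_one

theorem not_isUnit_p (p : ℕ) (K₀ C : Type*) [NontriviallyNormedField K₀] [IsUltrametricDist K₀]
    [CompleteSpace K₀] [IsPAdicField p K₀] [NormedField C] [IsUltrametricDist C]
    [NormedAlgebra K₀ C] : ¬ IsUnit (p : IntegerRing C) := by
  rintro ⟨u, hu⟩
  have h1 : ((u : IntegerRing C) : C) * ((u⁻¹ : (IntegerRing C)ˣ) : IntegerRing C) = 1 := by
    exact_mod_cast congrArg (Subtype.val) u.mul_inv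
  have h2 : ‖(((u⁻¹ : (IntegerRing C)ˣ) : IntegerRing C) : C)‖ ≤ 1 :=
    ((u⁻¹ : (IntegerRing C)ˣ) : IntegerRing C).2
  have h3 := congrArg norm h1
  rw [hu, norm_mul, norm_one] at h3
  have h4 : ‖(((p : IntegerRing C)) : C)‖ < 1 := by
    push_cast
    exact norm_p_lt_one p K₀ C
  nlinarith [norm_nonneg (((p : IntegerRing C)) : C)]

/-- The embedding family of the inclusions `K α ⊆ C`. -/
def inclusionFamily : D.EmbFamily := fun α =>
  ⟨(D.K α).val, continuous_subtype_val⟩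

instance : Nonempty D.𝔖 := ⟨Quotient.mk D.embSetoid D.inclusionFamily⟩

instance : Fact (¬ IsUnit (p : D.CompletedTensor)) := ⟨fun h => by
  have := h.map (D.beta D.inclusionFamily)
  rw [map_natCast] at this
  exact not_isUnit_p p K₀ C this⟩

/-- The tilt `lim_{x ↦ x ^ p} 𝒪_{K,Δ} / p` of `𝒪_{K,Δ}`. -/
abbrev Tilt : Type _ := PreTilt D.CompletedTensor p

/-- The map `β_s mod p`. -/
def betaModP (s : D.EmbFamily) : ModP D.CompletedTensor p →+* ModP (IntegerRing C) p :=
  Ideal.quotientMap _ (D.beta s) (by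
    rw [← Ideal.map_le_iff_le_comap, Ideal.map_span]; simp)

/-- The map `β_s^♭ : lim_{x ↦ x ^ p} 𝒪_{K,Δ} / p → lim_{x ↦ x ^ p} 𝒪_C / p`, followed by the
absolute value `x ↦ |x^♯|` of the tilt of `C`. -/
def embAbs (s : D.EmbFamily) : Valuation D.Tilt ℝ≥0 :=
  haveI : Fact (¬ IsUnit (p : IntegerRing C)) := ⟨not_isUnit_p p K₀ C⟩
  (PreTilt.val C (NormedField.valuation (K := C)) (IntegerRing C)
    (Valuation.integer.integers _) p).comap
    (show D.Tilt →+* PreTilt (IntegerRing C) p from Perfection.map p (D.betaModP s))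

/-- The absolute value `|·|_s` on the tilt of `𝒪_{K,Δ}`, for `s ∈ 𝔖`. It does not depend on the chosen
representative of the class `s`, since the isomorphisms `K_s ≃ K_s'` over `K₀` are isometric. -/
def tiltAbs (s : D.𝔖) : Valuation D.Tilt ℝ≥0 := D.embAbs (Quotient.out s)

theorem preTilt_val_le_one {F O : Type*} [Field F] [CommRing O] [Algebra O F] (v : Valuation F ℝ≥0)
    (hv : v.Integers O) [Fact (¬ IsUnit (p : O))] (x : PreTilt O p) :
    PreTilt.val F v O hv p x ≤ 1 := by
  have h : ∀ y : ModP O p, ModP.preVal F v O p y ≤ 1 := fun y => by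
    unfold ModP.preVal
    split_ifs
    · exact zero_le_one
    · exact hv.2 _
  change PreTilt.valAux F v O p x ≤ 1
  unfold PreTilt.valAux
  split_ifs
  · exact pow_le_one₀ zero_le (h _)
  · exact zero_le_one

theorem tiltAbs_le_one (s : D.𝔖) (x : D.Tilt) : D.tiltAbs s x ≤ 1 :=
  haveI : Fact (¬ IsUnit (p : IntegerRing C)) := ⟨not_isUnit_p p K₀ C⟩
  preTilt_val_le_one _ (Valuation.integer.integers _) _

end beta

end PerfectoidFamily

end

/-- A ring with a family of multiplicative non-archimedean absolute values bounded by `1`. -/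
structure AbsFamily (A : Type*) [CommRing A] (ι : Type*) where
  abs : ι → Valuation A ℝ≥0
  abs_le_one : ∀ s x, abs s x ≤ 1

/-- The tilt of `𝒪_{K,Δ}` with the absolute values `|·|_s`, `s ∈ 𝔖`. -/
def PerfectoidFamily.absFamily {p : ℕ} {K₀ C Δ : Type*} [NontriviallyNormedField K₀]
    [IsUltrametricDist K₀] [CompleteSpace K₀] [NormedField C] [IsUltrametricDist C]
    [NormedAlgebra K₀ C] [Fintype Δ] [Fact p.Prime] [IsPAdicField p K₀] [CompleteSpace C]
    (D : PerfectoidFamily p K₀ C Δ) : AbsFamily D.Tilt D.𝔖 where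
  abs := D.tiltAbs
  abs_le_one := D.tiltAbs_le_one

namespace AbsFamily

variable {A : Type*} [CommRing A] {ι : Type*} (V : AbsFamily A ι)

/-- `|x| = sup_s |x|_s`. -/
def norm (x : A) : ℝ := ⨆ s, (V.abs s x : ℝ)

theorem bddAbove_abs (x : A) : BddAbove (Set.range fun s => (V.abs s x : ℝ)) :=
  ⟨1, by rintro _ ⟨s, rfl⟩; exact_mod_cast V.abs_le_one s x⟩

theorem abs_le_norm (s : ι) (x : A) : (V.abs s x : ℝ) ≤ V.norm x :=
  le_ciSup (V.bddAbove_abs x) s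

theorem norm_nonneg (x : A) : 0 ≤ V.norm x := Real.iSup_nonneg fun _ => NNReal.coe_nonneg _

/-- The ideal `𝔥 = {x | |x| < 1}`. -/
def 𝔥 : Ideal A where
  carrier := {x | V.norm x < 1}
  zero_mem' := lt_of_le_of_lt (Real.iSup_le (fun s => by simp) le_rfl) zero_lt_one
  add_mem' := by
    intro x y hx hy
    refine lt_of_le_of_lt (Real.iSup_le (fun s => ?_) ?_) (max_lt hx hy)
    · have h := (V.abs s).map_add x y
      have h' : (V.abs s (x + y) : ℝ) ≤ max (V.abs s x : ℝ) (V.abs s y : ℝ) := by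
        exact_mod_cast h
      exact h'.trans (max_le_max (V.abs_le_norm s x) (V.abs_le_norm s y))
    · exact le_max_of_le_left (V.norm_nonneg x)
  smul_mem' := by
    intro c x hx
    refine lt_of_le_of_lt (Real.iSup_le (fun s => ?_) (V.norm_nonneg x)) hx
    refine le_trans ?_ (V.abs_le_norm s x)
    rw [smul_eq_mul, map_mul, NNReal.coe_mul]
    exact mul_le_of_le_one_left (NNReal.coe_nonneg _) (by exact_mod_cast V.abs_le_one s c)

/-- `ϖ` is a pseudo-uniformizer: a non-zero-divisor whose absolute values `|ϖ|_s` have a common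
value in `(0, 1)`. -/
def IsPseudoUniformizer (ϖ : A) : Prop :=
  ϖ ∈ nonZeroDivisors A ∧ ∃ r : ℝ, 0 < r ∧ r < 1 ∧ ∀ s, (V.abs s ϖ : ℝ) = r

end AbsFamily

/-- `K` is a ring of fractions of `A` in which `ϖ` is invertible and whose denominators are
non-zero-divisors, e.g. `A[1/ϖ]` or the total ring of fractions of `A`. -/
def IsRingOfFractions {A : Type*} [CommRing A] (ϖ : A) (K : Type*) [CommRing K] [Algebra A K] :
    Prop :=
  ∃ M : Submonoid A, M ≤ nonZeroDivisors A ∧ ϖ ∈ M ∧ IsLocalization M K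

/-- A Banach `K`-algebra structure on `R`, where `K` is a ring of fractions of a ring `A` with a
family of absolute values `|·|_s`: a family of norms `‖·‖_s` on `R`. -/
structure BanachAlgebra {A ι : Type*} [CommRing A] (V : AbsFamily A ι) (K R : Type*) [CommRing K]
    [CommRing R] [Algebra A K] [Algebra K R] where
  nrm : ι → R → ℝ
  nonneg : ∀ s x, 0 ≤ nrm s x
  add_le : ∀ s x y, nrm s (x + y) ≤ max (nrm s x) (nrm s y)
  /-- `‖(a / b) x‖_s = |a / b|_s ‖x‖_s`, with denominators cleared -/
  smul : ∀ s (a b : A) (c : K) (x : R), algebraMap A K b * c = algebraMap A K a →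
    V.abs s b * nrm s (c • x) = V.abs s a * nrm s x
  mul_le : ∀ s x y, nrm s (x * y) ≤ nrm s x * nrm s y
  /-- `‖1‖_s = 1`, unless `‖·‖_s` vanishes -/
  one : ∀ s, (∃ x, nrm s x ≠ 0) → nrm s 1 = 1
  bddAbove : ∀ x, BddAbove (Set.range fun s => nrm s x)
  separated : ∀ x, (∀ s, nrm s x = 0) → x = 0
  complete : ∀ u : ℕ → R,
    (∀ ε : ℝ, 0 < ε → ∃ N, ∀ m ≥ N, ∀ n ≥ N, (⨆ s, nrm s (u m - u n)) < ε) →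
    ∃ x, ∀ ε : ℝ, 0 < ε → ∃ N, ∀ n ≥ N, (⨆ s, nrm s (u n - x)) < ε

namespace BanachAlgebra

variable {A ι : Type*} [CommRing A] {V : AbsFamily A ι} {K R : Type*} [CommRing K] [CommRing R]
  [Algebra A K] [Algebra K R] (N : BanachAlgebra V K R)

/-- `‖x‖ = sup_s ‖x‖_s`. -/
def norm (x : R) : ℝ := ⨆ s, N.nrm s x

theorem nrm_le_norm (s : ι) (x : R) : N.nrm s x ≤ N.norm x := le_ciSup (N.bddAbove x) s

theorem norm_nonneg (x : R) : 0 ≤ N.norm x := Real.iSup_nonneg fun s => N.nonneg s x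

theorem nrm_zero (s : ι) : N.nrm s 0 = 0 := by
  simpa using N.smul s 0 1 0 0 (by simp)

theorem nrm_neg (s : ι) (x : R) : N.nrm s (-x) = N.nrm s x := by
  simpa using N.smul s (-1) 1 (-1) x (by simp)

theorem norm_zero : N.norm 0 = 0 := by
  simp [norm, N.nrm_zero]

theorem norm_neg (x : R) : N.norm (-x) = N.norm x := by
  simp [norm, N.nrm_neg]

theorem norm_add_le_max (x y : R) : N.norm (x + y) ≤ max (N.norm x) (N.norm y) :=
  Real.iSup_le (fun s => (N.add_le s x y).trans
    (max_le_max (N.nrm_le_norm s x) (N.nrm_le_norm s y))) (le_max_of_le_left (N.norm_nonneg x))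

theorem norm_mul_le (x y : R) : N.norm (x * y) ≤ N.norm x * N.norm y :=
  Real.iSup_le (fun s => (N.mul_le s x y).trans (mul_le_mul (N.nrm_le_norm s x)
    (N.nrm_le_norm s y) (N.nonneg s y) (N.norm_nonneg x)))
    (mul_nonneg (N.norm_nonneg x) (N.norm_nonneg y))

/-- The norm `‖·‖` as a Mathlib norm on the additive group of `R`. -/
def addGroupNorm : AddGroupNorm R where
  toFun := N.norm
  map_zero' := N.norm_zero
  add_le' x y := (N.norm_add_le_max x y).trans
    (max_le_add_of_nonneg (N.norm_nonneg x) (N.norm_nonneg y))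
  neg' := N.norm_neg
  eq_zero_of_map_eq_zero' x hx := N.separated x fun s =>
    le_antisymm ((N.nrm_le_norm s x).trans hx.le) (N.nonneg s x)

/-- The topology of `R`, defined by the metric `‖x - y‖`. -/
@[reducible] def topology : TopologicalSpace R :=
  N.addGroupNorm.toNormedAddCommGroup.toUniformSpace.toTopologicalSpace

theorem norm_pow_mul_pow_le {x y : R} {c d : ℝ} (hx : ∀ n, N.norm (x ^ n) ≤ c)
    (hy : ∀ n, N.norm (y ^ n) ≤ d) (n i j : ℕ) :
    N.norm ((x + y) ^ n * (x ^ i * y ^ j)) ≤ c * d := by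
  induction n generalizing i j with
  | zero =>
    rw [pow_zero, one_mul]
    exact (N.norm_mul_le _ _).trans (mul_le_mul (hx i) (hy j) (N.norm_nonneg _)
      ((N.norm_nonneg _).trans (hx i)))
  | succ n ih =>
    have h : (x + y) ^ (n + 1) * (x ^ i * y ^ j) =
        (x + y) ^ n * (x ^ (i + 1) * y ^ j) + (x + y) ^ n * (x ^ i * y ^ (j + 1)) := by ring
    rw [h]
    exact (N.norm_add_le_max _ _).trans (max_le (ih _ _) (ih _ _))

variable [Algebra A R] [IsScalarTower A K R]

theorem norm_algebraMap_mul_le (a : A) (x : R) : N.norm (algebraMap A R a * x) ≤ N.norm x := by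
  refine Real.iSup_le (fun s => ?_) (N.norm_nonneg x)
  have h := N.smul s a 1 (algebraMap A K a) x (by simp)
  rw [map_one, NNReal.coe_one, one_mul, algebraMap_smul, Algebra.smul_def] at h
  rw [h]
  exact (mul_le_of_le_one_left (N.nonneg s x) (by exact_mod_cast V.abs_le_one s a)).trans
    (N.nrm_le_norm s x)

/-- The ring `R°` of power-bounded elements. -/
def powerBounded : Subalgebra A R where
  carrier := {x | ∃ c : ℝ, ∀ n : ℕ, N.norm (x ^ n) ≤ c}
  mul_mem' := by
    rintro x y ⟨c, hc⟩ ⟨d, hd⟩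
    refine ⟨c * d, fun n => ?_⟩
    rw [mul_pow]
    exact (N.norm_mul_le _ _).trans (mul_le_mul (hc n) (hd n) (N.norm_nonneg _)
      ((N.norm_nonneg _).trans (hc n)))
  add_mem' := by
    rintro x y ⟨c, hc⟩ ⟨d, hd⟩
    exact ⟨c * d, fun n => by simpa using N.norm_pow_mul_pow_le hc hd n 0 0⟩
  algebraMap_mem' a := ⟨N.norm 1, fun n => by
    simpa using N.norm_algebraMap_mul_le (a ^ n) 1⟩

/-- `R` is perfectoid: `R°` is open and bounded, and the Frobenius of `R° / ϖ` is surjective. -/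
structure IsPerfectoid (p : ℕ) (ϖ : A) : Prop where
  isOpen : @IsOpen R N.topology (N.powerBounded : Set R)
  bounded : ∃ c : ℝ, ∀ x ∈ N.powerBounded, N.norm x ≤ c
  frobenius : ∀ x : N.powerBounded, ∃ y : N.powerBounded,
    algebraMap A N.powerBounded ϖ ∣ x - y ^ p

end BanachAlgebra

section Almost

universe u

variable {V : Type u} [CommRing V] (𝔥 : Ideal V) (B : Type v) [CommRing B] [Algebra V B]
  (N : Type v) [AddCommGroup N] [Module B N]

/-- `N^a` is a flat `B^a`-module: `X ↦ N ⊗ X` is exact up to almost zero modules. -/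
def AlmostFlat : Prop :=
  ∀ (X Y : Type v) [AddCommGroup X] [AddCommGroup Y] [Module B X] [Module B Y] (f : X →ₗ[B] Y),
    Function.Injective f → ∀ z : N ⊗[B] X, f.lTensor N z = 0 →
      ∀ ε ∈ 𝔥, algebraMap V B ε • z = 0

/-- `N^a` is an almost projective `B^a`-module: `X ↦ Hom (N, X)` is exact up to almost zero
modules. -/
def AlmostProjective : Prop :=
  ∀ (X Y : Type v) [AddCommGroup X] [AddCommGroup Y] [Module B X] [Module B Y] (g : X →ₗ[B] Y),
    Function.Surjective g → ∀ f : N →ₗ[B] Y, ∀ ε ∈ 𝔥,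
      ∃ f' : N →ₗ[B] X, g ∘ₗ f' = algebraMap V B ε • f

/-- The kernel and the cokernel of `f` are annihilated by `ε`. -/
def KerCokerKilledBy {B N P : Type*} [CommRing B] [AddCommGroup N] [Module B N] [AddCommGroup P]
    [Module B P] (f : P →ₗ[B] N) (ε : B) : Prop :=
  (∀ x, f x = 0 → ε • x = 0) ∧ ∀ y, ∃ x, f x = ε • y

/-- `N^a` is an almost finitely generated `B^a`-module. -/
def AlmostFG : Prop :=
  ∀ ε ∈ 𝔥, ∃ (P : Type v) (_ : AddCommGroup P) (_ : Module B P) (f : P →ₗ[B] N),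
    Module.Finite B P ∧ KerCokerKilledBy f (algebraMap V B ε)

/-- `N^a` is an almost finitely presented `B^a`-module. -/
def AlmostFP : Prop :=
  ∀ ε ∈ 𝔥, ∃ (P : Type v) (_ : AddCommGroup P) (_ : Module B P) (f : P →ₗ[B] N),
    Module.FinitePresentation B P ∧ KerCokerKilledBy f (algebraMap V B ε)

/-- `N^a` is a uniformly almost finitely generated `B^a`-module: the approximating modules can be
generated by `n` elements, with `n` independent of `ε`. -/
def UniformlyAlmostFG : Prop :=
  ∃ n : ℕ, ∀ ε ∈ 𝔥, ∃ (P : Type v) (_ : AddCommGroup P) (_ : Module B P) (f : P →ₗ[B] N),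
    (∃ g : Fin n → P, Submodule.span B (Set.range g) = ⊤) ∧ KerCokerKilledBy f (algebraMap V B ε)

/-- `N^a` is a uniformly finite projective `B^a`-module. -/
structure UniformlyFiniteProjective : Prop where
  flat : AlmostFlat 𝔥 B N
  fp : AlmostFP 𝔥 B N
  projective : AlmostProjective 𝔥 B N
  fg : AlmostFG 𝔥 B N
  uniform : UniformlyAlmostFG 𝔥 B N

/-- `B^a → S^a` is unramified: there is an idempotent `e` of the ring
`(S ⊗ S)_* = Hom_V (𝔥, S ⊗ S)` of almost elements with `μ(e) = 1` that annihilates the almost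
elements of the kernel of the multiplication `μ : S ⊗ S → S`. (The product of two almost elements
`x` and `y` satisfies `(x y)(ε δ) = x(ε) y(δ)`.) -/
def AlmostUnramified (S : Type v) [CommRing S] [Algebra V S] [Algebra B S] [IsScalarTower V B S] :
    Prop :=
  ∃ e : 𝔥 →ₗ[V] S ⊗[B] S,
    (∀ ε δ : 𝔥, e ε * e δ = e ((ε : V) • δ)) ∧
    (∀ ε : 𝔥, Algebra.TensorProduct.lmul' B (e ε) = algebraMap V S ε) ∧
    ∀ x : 𝔥 →ₗ[V] S ⊗[B] S, (∀ ε : 𝔥, Algebra.TensorProduct.lmul' B (x ε) = 0) →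
      ∀ ε δ : 𝔥, x ε * e δ = 0

/-- `B^a → S^a` is finite étale: unramified, flat and almost finitely presented. -/
structure AlmostFiniteEtale (S : Type v) [CommRing S] [Algebra V S] [Algebra B S]
    [IsScalarTower V B S] : Prop where
  unramified : AlmostUnramified 𝔥 B S
  flat : AlmostFlat 𝔥 B S
  fp : AlmostFP 𝔥 B S

end Almost

namespace BanachAlgebra

universe u w t

variable {A : Type u} {ι : Type w} [CommRing A] {V : AbsFamily A ι} {K : Type t} {R S : Type v}
  [CommRing K] [CommRing R] [CommRing S] [Algebra A K] [Algebra K R] [Algebra A R]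
  [IsScalarTower A K R] [Algebra K S] [Algebra A S] [IsScalarTower A K S] [Algebra R S]
  [IsScalarTower K R S]

/-- The map `R° → S°` induced by `R → S`, when it exists. -/
def powerBoundedMap (N : BanachAlgebra V K R) (N' : BanachAlgebra V K S)
    (h : ∀ x ∈ N.powerBounded, algebraMap R S x ∈ N'.powerBounded) :
    N.powerBounded →ₐ[A] N'.powerBounded where
  __ := ((algebraMap R S).comp N.powerBounded.val.toRingHom).codRestrict N'.powerBounded
    fun x => h x x.2
  commutes' a := Subtype.ext (by
    change algebraMap R S (algebraMap A R a) = algebraMap A S a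
    rw [IsScalarTower.algebraMap_apply A K R, IsScalarTower.algebraMap_apply A K S,
      ← IsScalarTower.algebraMap_apply K R S])

/-- `R → S` maps `R°` to `S°`, the almost algebra `S°^a` is finite étale over `R°^a`, and it is a
uniformly finite projective `R°^a`-module. -/
def IsAlmostFiniteEtaleOver (N' : BanachAlgebra V K S) (N : BanachAlgebra V K R) : Prop :=
  ∃ h : ∀ x ∈ N.powerBounded, algebraMap R S x ∈ N'.powerBounded,
    letI : Algebra N.powerBounded N'.powerBounded := (N.powerBoundedMap N' h).toRingHom.toAlgebra
    haveI : IsScalarTower A N.powerBounded N'.powerBounded :=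
      IsScalarTower.of_algebraMap_eq fun a => ((N.powerBoundedMap N' h).commutes a).symm
    AlmostFiniteEtale V.𝔥 N.powerBounded N'.powerBounded ∧
      UniformlyFiniteProjective V.𝔥 N.powerBounded N'.powerBounded

end BanachAlgebra

end DeltaPerfectoid

end

/-!
The proof is Faltings' argument for almost purity in characteristic `p`: the separability idempotent
of `S ⊗[R] S` is invariant under the inverse of Frobenius, which improves any bound on its
denominator to an arbitrarily good one.

Write `e = ∑ aᵢ ⊗ bᵢ` for the idempotent and `τ : S → R` for the trace, built from a dual basis of
the finite projective `R`-module `S`. The two are dual to each other, `x = ∑ τ (bᵢ x) aᵢ`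
(`nonempty_etaleDatum`), and the algebra of `R → S` follows from this: `S` is reduced
(`EtaleDatum.isReduced`), perfect (`EtaleDatum.exists_pow_eq`), and `τ` commutes with Frobenius
(`EtaleDatum.τ_pow`). As `S ⊗[R] S` is reduced too, `e = ∑ aᵢ ^ (1 / p ^ n) ⊗ bᵢ ^ (1 / p ^ n)` for
all `n` (`EtaleDatum.e_eq_sum_of_pow`).

A perfectoid `R` is reduced because `R°` is bounded, and perfect because `R°` is complete
(`BanachAlgebra.isReduced`, `BanachAlgebra.exists_pow_eq`). The norm `‖x‖_s` on `S` is the operator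
norm of multiplication by `x` with respect to the maximum of the coordinates in the dual basis
(`BanachAlgebra.ofDualBasis`). It is submultiplicative for each single `s`, has `‖1‖_s = 1`, and is
bounded above and below by the coordinates with constants independent of `s`, so that it defines the
module topology.

Since `τ` commutes with Frobenius, it maps `S°` to `R°` (`BanachAlgebra.τ_mem_powerBounded`), and the
duality shows that `S°` is bounded. If `aᵢ` and `bᵢ` lie in `ϖ⁻ⁿ S°`, their `p ^ l`-th roots lie in
`ϖ ^ (-n / p ^ l) S°`; hence every `ε e` with `ε ∈ 𝔥` is a sum of a fixed number `m` of tensors of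
elements of `S°` (`BanachAlgebra.exists_smul_e_eq_sum`). By duality, multiplication by `ε` on `S°`
then factors through `(R°) ^ m`, which gives all finiteness, flatness and projectivity statements
(`IsAlmostSummand`). It also shows that the kernel of `S° ⊗ S° → S ⊗ S` is almost zero, so the
elements `ε e` lift to an almost element of `S° ⊗ S°`, and `S°` is almost unramified over `R°`
(`AlmostModel.almostUnramified`).
-/

namespace DeltaPerfectoid

/-! ### Rings in which a prime vanishes -/

section Char

variable {p : ℕ} [hp : Fact p.Prime] {R : Type*} [CommRing R]

theorem sum_pow_prime_pow (hR : (p : R) = 0) (n : ℕ) {κ : Type*} (s : Finset κ) (f : κ → R) :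
    (∑ i ∈ s, f i) ^ p ^ n = ∑ i ∈ s, f i ^ p ^ n := by
  nontriviality R
  have : CharP R p := (CharP.charP_iff_prime_eq_zero hp.1).mpr hR
  exact sum_pow_char_pow p n s f

theorem sub_pow_prime_pow (hR : (p : R) = 0) (n : ℕ) (x y : R) :
    (x - y) ^ p ^ n = x ^ p ^ n - y ^ p ^ n := by
  nontriviality R
  have : CharP R p := (CharP.charP_iff_prime_eq_zero hp.1).mpr hR
  exact sub_pow_char_pow x y n

theorem pow_prime_pow_injective [IsReduced R] (hR : (p : R) = 0) (n : ℕ) {x y : R}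
    (h : x ^ p ^ n = y ^ p ^ n) : x = y := by
  rw [← sub_eq_zero, ← sub_pow_prime_pow hR] at h
  exact sub_eq_zero.mp (pow_eq_zero_iff (pow_ne_zero _ hp.1.ne_zero) |>.mp h)

end Char

theorem natCast_eq_zero_of_algebra (R : Type*) {S : Type*} [CommRing R] [CommRing S] [Algebra R S]
    {n : ℕ} (hR : (n : R) = 0) : (n : S) = 0 := by
  rw [← map_natCast (algebraMap R S), hR, map_zero]

theorem exists_pow_prime_pow_eq {p : ℕ} {R : Type*} [Monoid R] (h : ∀ x : R, ∃ y, y ^ p = x) (n : ℕ)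
    (x : R) : ∃ y, y ^ p ^ n = x := by
  induction n generalizing x with
  | zero => exact ⟨x, by simp⟩
  | succ n ih =>
    obtain ⟨y, rfl⟩ := h x
    obtain ⟨z, rfl⟩ := ih y
    exact ⟨z, by rw [pow_succ, pow_mul]⟩

/-! ### The separability idempotent and the trace of a finite étale algebra -/

section Etale

variable {R S : Type*} [CommRing R] [CommRing S] [Algebra R S]

/-- The map `a ⊗ b ↦ φ b • a`. -/
noncomputable def slice (φ : S →ₗ[R] R) : S ⊗[R] S →ₗ[R] S :=
  (TensorProduct.rid R S).toLinearMap ∘ₗ φ.lTensor S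

@[simp] theorem slice_tmul (φ : S →ₗ[R] R) (a b : S) : slice φ (a ⊗ₜ b) = φ b • a := by
  simp [slice]

theorem slice_one_tmul_mul (φ : S →ₗ[R] R) (x : S) (w : S ⊗[R] S) :
    slice φ ((1 ⊗ₜ x) * w) = slice (φ ∘ₗ LinearMap.mulLeft R x) w := by
  induction w with
  | zero => simp
  | tmul a b => simp
  | add a b ha hb => simp [mul_add, ha, hb]

theorem slice_tmul_one_mul (φ : S →ₗ[R] R) (x : S) (w : S ⊗[R] S) :
    slice φ ((x ⊗ₜ 1) * w) = x * slice φ w := by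
  induction w with
  | zero => simp
  | tmul a b => simp
  | add a b ha hb => simp [mul_add, ha, hb]

variable (R S) in
/-- A finite dual basis of a finite projective module exhibits it as a direct summand of a free
module: `y = ∑ coord i y • vec i`. -/
structure DualBasis where
  n : ℕ
  coord : Fin n → S →ₗ[R] R
  vec : Fin n → S
  sum_coord_smul (y : S) : ∑ i, coord i y • vec i = y

theorem nonempty_dualBasis [Algebra.Etale R S] [Module.Finite R S] : Nonempty (DualBasis R S) := by
  have := Module.FinitePresentation.of_finite_of_finitePresentation R S
  have : Module.Projective R S := Module.Flat.projective_of_finitePresentation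
  obtain ⟨n, f, g, -, -, hfg⟩ := Module.Finite.exists_comp_eq_id_of_projective R S
  refine ⟨⟨n, fun i => LinearMap.proj i ∘ₗ g, fun i => f (Pi.single i 1), fun y => ?_⟩⟩
  conv_rhs => rw [← LinearMap.id_apply (R := R) y, ← hfg, LinearMap.comp_apply,
    pi_eq_sum_univ' (g y), map_sum]
  simp

/-- The trace of multiplication by an element. -/
noncomputable def DualBasis.trace (b : DualBasis R S) : S →ₗ[R] R :=
  ∑ i, b.coord i ∘ₗ LinearMap.mulLeft R (b.vec i)

/-- The matrix by which `x` acts on the free module of which `S` is a direct summand. -/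
noncomputable def DualBasis.matrix (b : DualBasis R S) (x : S) : Matrix (Fin b.n) (Fin b.n) R :=
  Matrix.of fun i j => b.coord i (x * b.vec j)

theorem DualBasis.matrix_mul (b : DualBasis R S) (x y : S) :
    b.matrix (x * y) = b.matrix x * b.matrix y := by
  ext i j
  rw [Matrix.mul_apply]
  simp only [DualBasis.matrix, Matrix.of_apply]
  conv_lhs => rw [mul_assoc, ← b.sum_coord_smul (y * b.vec j), Finset.mul_sum, map_sum]
  exact Finset.sum_congr rfl fun k _ => by simp [mul_comm]

theorem DualBasis.trace_eq (b : DualBasis R S) (x : S) : b.trace x = (b.matrix x).trace := by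
  simp [DualBasis.trace, DualBasis.matrix, Matrix.trace, mul_comm]

theorem DualBasis.isNilpotent_trace (b : DualBasis R S) {x : S} (hx : IsNilpotent x) :
    IsNilpotent (b.trace x) := by
  rw [b.trace_eq]
  refine Matrix.isNilpotent_trace_of_isNilpotent ?_
  obtain ⟨n, hn⟩ := hx
  have h : ∀ k, b.matrix (x ^ (k + 1)) = b.matrix x ^ (k + 1) := fun k => by
    induction k with
    | zero => simp
    | succ k ih => rw [pow_succ, b.matrix_mul, ih, ← pow_succ]
  refine ⟨n + 1, ?_⟩
  rw [← h, pow_succ, hn, zero_mul]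
  ext i j
  simp [DualBasis.matrix]

/-- If `R → S` is injective, the linear forms on `S` generate the unit ideal of `R`. -/
theorem DualBasis.span_coord_eq_top (b : DualBasis R S)
    (h : Function.Injective (algebraMap R S)) :
    Ideal.span {r | ∃ i y, b.coord i y = r} = ⊤ := by
  set I := Ideal.span {r | ∃ i y, b.coord i y = r}
  have hfg : (⊤ : Submodule R S).FG := by
    convert Submodule.fg_span (R := R) (Set.finite_range b.vec)
    refine (eq_top_iff.mpr fun y _ => ?_).symm
    rw [← b.sum_coord_smul y]
    exact Submodule.sum_mem _ fun i _ => Submodule.smul_mem _ _ (Submodule.subset_span ⟨i, rfl⟩)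
  have h1 : (⊤ : Submodule R S) ≤ I • ⊤ := fun y _ => by
    rw [← b.sum_coord_smul y]
    exact Submodule.sum_mem _ fun i _ => Submodule.smul_mem_smul
      (Ideal.subset_span ⟨i, y, rfl⟩) Submodule.mem_top
  obtain ⟨t, ht, ht0⟩ := Submodule.exists_sub_one_mem_and_smul_eq_zero_of_fg_of_le_smul I ⊤
    hfg h1
  have h2 : t = 0 := h (by
    rw [map_zero, Algebra.algebraMap_eq_smul_one]; exact ht0 1 Submodule.mem_top)
  rw [h2, zero_sub] at ht
  rw [Ideal.eq_top_iff_one]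
  exact (Ideal.neg_mem_iff I).mp ht

variable (R S) in
/-- The separability idempotent `e = ∑ aᵢ ⊗ bᵢ` of a finite étale algebra together with its trace
form `τ`, which is dual to `e`: `x = ∑ τ (bᵢ x) • aᵢ`. -/
structure EtaleDatum where
  e : S ⊗[R] S
  τ : S →ₗ[R] R
  one_tmul_mul (x : S) : (1 ⊗ₜ x) * e = (x ⊗ₜ 1) * e
  lmul_e : Algebra.TensorProduct.lmul' R e = 1
  slice_e (x : S) : slice (τ ∘ₗ LinearMap.mulLeft R x) e = x
  isNilpotent_τ {x : S} : IsNilpotent x → IsNilpotent (τ x)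

namespace EtaleDatum

variable (E : EtaleDatum R S)

theorem mul_e (w : S ⊗[R] S) : w * E.e = (Algebra.TensorProduct.lmul' R w ⊗ₜ 1) * E.e := by
  induction w with
  | zero => simp
  | tmul a b =>
    have h : (a ⊗ₜ[R] b : S ⊗[R] S) = (a ⊗ₜ 1) * (1 ⊗ₜ b) := by simp
    rw [h, mul_assoc, E.one_tmul_mul, ← mul_assoc]
    simp
  | add a b ha hb => rw [add_mul, ha, hb, map_add, TensorProduct.add_tmul, add_mul]

theorem e_mul_self : E.e * E.e = E.e := by
  rw [E.mul_e, E.lmul_e, ← Algebra.TensorProduct.one_def, one_mul]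

theorem mul_e_eq_zero {w : S ⊗[R] S} (hw : Algebra.TensorProduct.lmul' R w = 0) :
    w * E.e = 0 := by
  rw [E.mul_e, hw, TensorProduct.zero_tmul, zero_mul]

theorem e_pow {n : ℕ} (hn : n ≠ 0) : E.e ^ n = E.e :=
  IsIdempotentElem.pow_eq E.e_mul_self hn

/-- The separability idempotent is unique, hence symmetric. -/
theorem comm_e : TensorProduct.comm R S S E.e = E.e := by
  have h1 : ∀ w : S ⊗[R] S, TensorProduct.comm R S S w = Algebra.TensorProduct.comm R S S w :=
    fun w => rfl
  have h2 : Algebra.TensorProduct.lmul' R (TensorProduct.comm R S S E.e) = 1 := by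
    rw [← E.lmul_e]
    generalize E.e = w
    induction w with
    | zero => simp
    | tmul a b => simp [mul_comm]
    | add a b ha hb => simp only [map_add, ha, hb]
  have h3 : TensorProduct.comm R S S E.e * E.e = E.e := by
    rw [E.mul_e, h2, ← Algebra.TensorProduct.one_def, one_mul]
  have h4 := congrArg (Algebra.TensorProduct.comm R S S) h3
  have h5 : Algebra.TensorProduct.comm R S S (Algebra.TensorProduct.comm R S S E.e) = E.e :=
    (Algebra.TensorProduct.comm R S S).symm_apply_apply E.e
  rw [map_mul, h1, h5, mul_comm, ← h1, h3] at h4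
  exact h4.symm

section Sum

variable {m : ℕ} {a b : Fin m → S}

/-- The duality between `τ` and a multiple `r e = ∑ aᵢ ⊗ bᵢ`. -/
theorem sum_τ_smul {r : R} (h : r • E.e = ∑ i, a i ⊗ₜ[R] b i) (x : S) :
    ∑ i, E.τ (b i * x) • a i = r • x := by
  conv_rhs => rw [← E.slice_e x, ← map_smul, h, map_sum]
  simp [mul_comm]

theorem sum_τ_smul' (h : E.e = ∑ i, a i ⊗ₜ[R] b i) (x : S) :
    ∑ i, E.τ (a i * x) • b i = x := by
  have h' : (1 : R) • E.e = ∑ i, b i ⊗ₜ[R] a i := by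
    rw [one_smul, ← E.comm_e, h]
    simp
  simpa using E.sum_τ_smul h' x

end Sum

/-- For nilpotent `x` the elements `τ (b x)` of `R` are nilpotent, hence zero, and they determine
`x`. -/
theorem isReduced (E : EtaleDatum R S) [IsReduced R] : IsReduced S := by
  refine ⟨fun x hx => ?_⟩
  obtain ⟨m, a, b, h⟩ := TensorProduct.exists_sum_tmul_eq E.e
  rw [← one_smul R x, ← E.sum_τ_smul (r := 1) (by rw [one_smul]; exact h)]
  refine Finset.sum_eq_zero fun i _ => ?_
  have : IsNilpotent (b i * x) := (Commute.all _ _).isNilpotent_mul_left hx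
  rw [(E.isNilpotent_τ this).eq_zero, zero_smul]

end EtaleDatum

/-- The trace is dual to the separability idempotent: `(coord i ⊗ vec i) e` can be computed after
moving `vec i` and `x` to the other tensor factor, and `∑ coord i (·) • vec i` is the identity. -/
theorem nonempty_etaleDatum [Algebra.Etale R S] [Module.Finite R S] :
    Nonempty (EtaleDatum R S) := by
  obtain ⟨d⟩ := nonempty_dualBasis (R := R) (S := S)
  obtain ⟨e, he, hμ⟩ :=
    (Algebra.FormallyUnramified.iff_exists_tensorProduct (R := R) (S := S)).mp inferInstance
  have he' : ∀ x : S, (1 ⊗ₜ x) * e = (x ⊗ₜ 1) * e := fun x => by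
    rw [← sub_eq_zero, ← sub_mul, he]
  refine ⟨⟨e, d.trace, he', hμ, fun x => ?_, d.isNilpotent_trace⟩⟩
  have h1 : ∀ w : S ⊗[R] S, ∑ i, d.vec i * slice (d.coord i) w =
      Algebra.TensorProduct.lmul' R w := fun w => by
    induction w with
    | zero => simp
    | tmul a b =>
      conv_rhs => rw [Algebra.TensorProduct.lmul'_apply_tmul, ← d.sum_coord_smul b, Finset.mul_sum]
      exact Finset.sum_congr rfl fun i _ => by simp [mul_comm]
    | add a b ha hb => simp only [map_add, mul_add, Finset.sum_add_distrib, ha, hb]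
  have h2 : ∀ i, slice ((d.coord i ∘ₗ LinearMap.mulLeft R (d.vec i)) ∘ₗ LinearMap.mulLeft R x) e =
      x * (d.vec i * slice (d.coord i) e) := fun i => by
    rw [← slice_one_tmul_mul, he', slice_tmul_one_mul, ← slice_one_tmul_mul, he',
      slice_tmul_one_mul]
  have h3 : ∀ w : S ⊗[R] S, slice (d.trace ∘ₗ LinearMap.mulLeft R x) w = ∑ i,
      slice ((d.coord i ∘ₗ LinearMap.mulLeft R (d.vec i)) ∘ₗ LinearMap.mulLeft R x) w := fun w => by
    induction w with
    | zero => simp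
    | tmul a b => simp [DualBasis.trace, Finset.sum_smul]
    | add a b ha hb => simp only [map_add, Finset.sum_add_distrib, ha, hb]
  rw [h3, Finset.sum_congr rfl fun i _ => h2 i, ← Finset.mul_sum, h1, hμ, mul_one]

section Perfect

variable {p : ℕ} [hp : Fact p.Prime]

variable (R) in
theorem isReduced_of_etale [Algebra.Etale R S] [Module.Finite R S] [IsReduced R] : IsReduced S :=
  (nonempty_etaleDatum (R := R)).some.isReduced

namespace EtaleDatum

variable (E : EtaleDatum R S)

/-- The separability idempotent is invariant under the inverse of Frobenius, since `S ⊗ S` is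
reduced. -/
theorem e_eq_sum_of_pow [Algebra.Etale R S] [Module.Finite R S] [IsReduced R] (hR : (p : R) = 0) {m : ℕ} {a b : Fin m → S} {n : ℕ}
    (h : E.e = ∑ i, (a i ^ p ^ n) ⊗ₜ[R] (b i ^ p ^ n)) : E.e = ∑ i, a i ⊗ₜ[R] b i := by
  have : Algebra.Etale R (S ⊗[R] S) := Algebra.Etale.comp R S _
  have : IsReduced (S ⊗[R] S) := isReduced_of_etale R
  have h0 : (p : S ⊗[R] S) = 0 := natCast_eq_zero_of_algebra R hR
  refine pow_prime_pow_injective h0 n ?_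
  rw [E.e_pow (pow_ne_zero _ hp.1.ne_zero), sum_pow_prime_pow h0, h]
  simp

/-- Since `e = e ^ p = ∑ aᵢ ^ p ⊗ bᵢ ^ p`, the `R`-module `S` is spanned by `p`-th powers. -/
theorem exists_pow_eq (E : EtaleDatum R S) (hR : (p : R) = 0) (hperf : ∀ x : R, ∃ y, y ^ p = x) (x : S) :
    ∃ y, y ^ p = x := by
  obtain ⟨m, a, b, h⟩ := TensorProduct.exists_sum_tmul_eq E.e
  have h0 : (p : S ⊗[R] S) = 0 := natCast_eq_zero_of_algebra R hR
  have h1 : (1 : R) • E.e = ∑ i, (a i ^ p) ⊗ₜ[R] (b i ^ p) := by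
    have := sum_pow_prime_pow h0 1 Finset.univ fun i => a i ⊗ₜ[R] b i
    rw [pow_one, ← h, E.e_pow hp.1.ne_zero] at this
    simpa using this
  choose r hr using hperf
  refine ⟨∑ i, r (E.τ (b i ^ p * x)) • a i, ?_⟩
  have := sum_pow_prime_pow (natCast_eq_zero_of_algebra (S := S) R hR) 1 Finset.univ
    fun i => r (E.τ (b i ^ p * x)) • a i
  rw [pow_one] at this
  have hx := E.sum_τ_smul h1 x
  rw [one_smul] at hx
  rw [this, ← hx]
  simp [smul_pow, hr, hx]

/-- The trace commutes with Frobenius. -/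
theorem τ_pow [IsReduced R] (hR : (p : R) = 0) (hperf : ∀ x : R, ∃ y, y ^ p = x) (n : ℕ) (x : S) :
    E.τ (x ^ p ^ n) = E.τ x ^ p ^ n := by
  obtain ⟨m, a, b, h⟩ := TensorProduct.exists_sum_tmul_eq E.e
  have hS0 : (p : S) = 0 := natCast_eq_zero_of_algebra R hR
  have hS := E.isReduced
  have h0 : (p : S ⊗[R] S) = 0 := natCast_eq_zero_of_algebra R hR
  have h1 : E.e = ∑ i, (a i ^ p ^ n) ⊗ₜ[R] (b i ^ p ^ n) := by
    have := sum_pow_prime_pow h0 n Finset.univ fun i => a i ⊗ₜ[R] b i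
    rw [← h, E.e_pow (pow_ne_zero _ hp.1.ne_zero)] at this
    simpa using this
  choose c hc using fun i => exists_pow_prime_pow_eq hperf n (E.τ (a i ^ p ^ n))
  -- `∑ cᵢ bᵢ` is a `pⁿ`-th root of `∑ τ (aᵢ ^ pⁿ) bᵢ ^ pⁿ = 1`
  have h2 : ∑ i, c i • b i = 1 := by
    refine pow_prime_pow_injective hS0 n ?_
    rw [sum_pow_prime_pow hS0, one_pow]
    simpa [smul_pow, hc] using E.sum_τ_smul' h1 1
  have h3 : ∑ i, E.τ (b i * x) • a i = x := by
    simpa using E.sum_τ_smul (r := 1) (by rw [one_smul]; exact h) x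
  calc E.τ (x ^ p ^ n) = (∑ i, E.τ (b i * x) * c i) ^ p ^ n := by
        conv_lhs => rw [← h3, sum_pow_prime_pow hS0]
        rw [sum_pow_prime_pow hR]
        simp [smul_pow, mul_pow, hc]
    _ = E.τ (x * ∑ i, c i • b i) ^ p ^ n := by
        simp [Finset.mul_sum, mul_comm]
    _ = E.τ x ^ p ^ n := by rw [h2, mul_one]

end EtaleDatum

end Perfect

end Etale

/-! ### Almost direct summands of free modules -/

section AlmostSummand

universe u

variable {V : Type u} [CommRing V] {𝔥 : Ideal V} {B : Type v} [CommRing B] [Algebra V B]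
  {N : Type v} [AddCommGroup N] [Module B N]

variable (𝔥 B N) in
/-- Multiplication by each `ε ∈ 𝔥` factors through the free module of rank `m`. -/
def IsAlmostSummand (m : ℕ) : Prop :=
  ∀ ε ∈ 𝔥, ∃ (α : N →ₗ[B] Fin m → B) (β : (Fin m → B) →ₗ[B] N),
    ∀ x, β (α x) = algebraMap V B ε • x

namespace IsAlmostSummand

variable {m : ℕ}

theorem almostFlat (H : IsAlmostSummand 𝔥 B N m) : AlmostFlat 𝔥 B N := by
  intro X Y _ _ _ _ f hf z hz ε hε
  obtain ⟨α, β, h⟩ := H ε hε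
  have h1 : f.lTensor (Fin m → B) (α.rTensor X z) = 0 := by
    rw [← LinearMap.comp_apply, LinearMap.lTensor_comp_rTensor, ← LinearMap.rTensor_comp_lTensor,
      LinearMap.comp_apply, hz, map_zero]
  have h2 : α.rTensor X z = 0 :=
    (injective_iff_map_eq_zero _).mp (Module.Flat.lTensor_preserves_injective_linearMap f hf) _ h1
  have h3 : β ∘ₗ α = algebraMap V B ε • LinearMap.id := LinearMap.ext h
  have h4 := congrArg (β.rTensor X) h2
  rw [← LinearMap.comp_apply, ← LinearMap.rTensor_comp, h3, LinearMap.rTensor_smul, map_zero] at h4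
  simpa using h4

theorem almostProjective (H : IsAlmostSummand 𝔥 B N m) : AlmostProjective 𝔥 B N := by
  intro X Y _ _ _ _ g hg f ε hε
  obtain ⟨α, β, h⟩ := H ε hε
  obtain ⟨l, hl⟩ := Module.projective_lifting_property g (f ∘ₗ β) hg
  refine ⟨l ∘ₗ α, ?_⟩
  ext x
  rw [← LinearMap.comp_assoc, hl]
  simp [h]

theorem uniformlyAlmostFG (H : IsAlmostSummand 𝔥 B N m) : UniformlyAlmostFG 𝔥 B N := by
  refine ⟨m, fun ε hε => ?_⟩
  obtain ⟨α, β, h⟩ := H ε hε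
  refine ⟨LinearMap.range β, inferInstance, inferInstance, (LinearMap.range β).subtype,
    ⟨fun i => ⟨β (Pi.single i 1), _, rfl⟩, ?_⟩, fun x hx => ?_, fun y => ?_⟩
  · rw [eq_top_iff]
    rintro ⟨_, c, rfl⟩ -
    have hc : (⟨β c, c, rfl⟩ : LinearMap.range β) =
        ∑ i, c i • (⟨β (Pi.single i 1), _, rfl⟩ : LinearMap.range β) := by
      apply Subtype.ext
      conv_lhs => rw [pi_eq_sum_univ' c]
      simp
    rw [hc]
    exact Submodule.sum_mem _ fun i _ =>
      Submodule.smul_mem _ _ (Submodule.subset_span ⟨i, rfl⟩)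
  · rw [(LinearMap.range β).subtype_injective (hx.trans (map_zero _).symm), smul_zero]
  · exact ⟨⟨_, α y, rfl⟩, h y⟩

/-- The cokernel of `α ∘ β - ε` on the free module is a finitely presented approximation of `N`. -/
theorem almostFP (H : IsAlmostSummand 𝔥 B N m) : AlmostFP 𝔥 B N := by
  intro ε hε
  obtain ⟨α, β, h⟩ := H ε hε
  set γ : (Fin m → B) →ₗ[B] (Fin m → B) := α ∘ₗ β - algebraMap V B ε • LinearMap.id with hγ
  have hβ : LinearMap.range γ ≤ LinearMap.ker β := by
    rintro _ ⟨x, rfl⟩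
    rw [LinearMap.mem_ker, hγ, LinearMap.sub_apply, map_sub, LinearMap.comp_apply, h,
      LinearMap.smul_apply, map_smul, LinearMap.id_apply, sub_self]
  refine ⟨(Fin m → B) ⧸ LinearMap.range γ, inferInstance, inferInstance,
    (LinearMap.range γ).liftQ β hβ, ?_, ?_, fun y => ⟨Submodule.Quotient.mk (α y), ?_⟩⟩
  · refine Module.finitePresentation_of_surjective _ (Submodule.mkQ_surjective _) ?_
    rw [Submodule.ker_mkQ, LinearMap.range_eq_map]
    exact (Module.Finite.fg_top).map _
  · intro x
    induction x using Submodule.Quotient.induction_on with | _ x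
    intro hx
    rw [← Submodule.mkQ_apply, Submodule.mkQ_apply, Submodule.liftQ_apply] at hx
    rw [← Submodule.Quotient.mk_smul, Submodule.Quotient.mk_eq_zero]
    exact ⟨-x, by simp [hγ, hx]⟩
  · rw [← h y]
    rfl

theorem uniformlyFiniteProjective (H : IsAlmostSummand 𝔥 B N m) :
    UniformlyFiniteProjective 𝔥 B N where
  flat := H.almostFlat
  fp := H.almostFP
  projective := H.almostProjective
  fg ε hε := by
    obtain ⟨n, hn⟩ := H.uniformlyAlmostFG
    obtain ⟨P, i, j, f, ⟨g, hg⟩, hf⟩ := hn ε hε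
    exact ⟨P, i, j, f, ⟨hg ▸ Submodule.fg_span (Set.finite_range g)⟩, hf⟩
  uniform := H.uniformlyAlmostFG

end IsAlmostSummand

end AlmostSummand

/-! ### The criterion for integral models to be almost finite étale -/

section AlmostEtale

universe u

variable {V : Type u} [CommRing V] {𝔥 : Ideal V} {B C R S : Type v} [CommRing B] [CommRing C]
  [CommRing R] [CommRing S] [Algebra V B] [Algebra B C]
  [Algebra B R] [Algebra R S] [Algebra C S] [Algebra B S]
  [IsScalarTower B R S] [IsScalarTower B C S]

variable (B C R S) in
/-- The map `C ⊗ C → S ⊗ S` of the integral models. -/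
noncomputable def tensorModelMap : C ⊗[B] C →ₐ[B] S ⊗[R] S :=
  Algebra.TensorProduct.lift
    ((Algebra.TensorProduct.includeLeft (R := R) (S := B) (A := S) (B := S)).comp
      (IsScalarTower.toAlgHom B C S))
    (((Algebra.TensorProduct.includeRight (R := R) (A := S) (B := S)).restrictScalars B).comp
      (IsScalarTower.toAlgHom B C S))
    fun _ _ => Commute.all _ _

@[simp] theorem tensorModelMap_tmul (x y : C) : tensorModelMap B C R S (x ⊗ₜ y) =
    algebraMap C S x ⊗ₜ algebraMap C S y := by
  simp [tensorModelMap]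

theorem lmul'_tensorModelMap (w : C ⊗[B] C) :
    Algebra.TensorProduct.lmul' R (tensorModelMap B C R S w) =
      algebraMap C S (Algebra.TensorProduct.lmul' B w) := by
  induction w with
  | zero => simp
  | tmul x y => simp
  | add x y hx hy => simp only [map_add, hx, hy]

variable (𝔥 B C) in
/-- Integral models `B → C` of a finite étale map `R → S` with separability idempotent `e` and
trace form `τ`: the trace maps `C` to `B`, and all multiples `ε e`, `ε ∈ 𝔥`, are sums of `m` tensors
of elements of `C`. -/
structure AlmostModel (E : EtaleDatum R S) (m : ℕ) where
  injective : Function.Injective (algebraMap C S)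
  trace : C →ₗ[B] B
  algebraMap_trace (x : C) : algebraMap B R (trace x) = E.τ (algebraMap C S x)
  exists_sum : ∀ ε ∈ 𝔥, ∃ a b : Fin m → C, algebraMap B R (algebraMap V B ε) • E.e =
    ∑ i, algebraMap C S (a i) ⊗ₜ[R] algebraMap C S (b i)

/-- Elements `t k` of `𝔥`, invertible on `R`, that exhaust `𝔥` in the sense that every element of `𝔥`
is divisible in `B` by the square of some `t k`. -/
structure ExhaustingSequence (𝔥 : Ideal V) (B R : Type*) [CommRing B] [CommRing R] [Algebra V B]
    [Algebra B R] (t : ℕ → V) : Prop where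
  mem (k : ℕ) : t k ∈ 𝔥
  dvd {k l : ℕ} : k ≤ l → t l ∣ t k
  isUnit (k : ℕ) : IsUnit (algebraMap B R (algebraMap V B (t k)))
  exists_eq_sq_mul : ∀ ε ∈ 𝔥, ∃ k, ∃ η : B, algebraMap V B ε = algebraMap V B (t k) ^ 2 * η

namespace AlmostModel

variable {E : EtaleDatum R S} {m : ℕ} (M : AlmostModel 𝔥 B C E m)

theorem sum_trace {ε : B} {a b : Fin m → C}
    (h : algebraMap B R ε • E.e = ∑ i, algebraMap C S (a i) ⊗ₜ[R] algebraMap C S (b i)) (x : C) :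
    ∑ i, M.trace (b i * x) • a i = ε • x := by
  apply M.injective
  have h1 := E.sum_τ_smul h (algebraMap C S x)
  have h2 : ∀ (r : B) (y : C), algebraMap C S (r • y) = algebraMap B R r • algebraMap C S y :=
    fun r y => by
      rw [Algebra.smul_def, map_mul, ← IsScalarTower.algebraMap_apply, algebraMap_smul,
        Algebra.smul_def]
  rw [h2, ← h1, map_sum]
  exact Finset.sum_congr rfl fun i _ => by rw [h2, M.algebraMap_trace, map_mul]

theorem isAlmostSummand (M : AlmostModel 𝔥 B C E m) : IsAlmostSummand 𝔥 B C m := by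
  intro ε hε
  obtain ⟨a, b, h⟩ := M.exists_sum ε hε
  refine ⟨LinearMap.pi fun i => M.trace ∘ₗ LinearMap.mulLeft B (b i),
    Fintype.linearCombination B a, fun x => ?_⟩
  rw [← M.sum_trace h x]
  simp [Fintype.linearCombination_apply]

/-- The kernel of `C ⊗ C → S ⊗ S` is almost zero: multiplication by `ε` on `C ⊗ C` factors through
`m` copies of `C`, and these embed into `S`. -/
theorem smul_eq_zero (M : AlmostModel 𝔥 B C E m) {w : C ⊗[B] C} (hw : tensorModelMap B C R S w = 0) {ε : V} (hε : ε ∈ 𝔥) :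
    algebraMap V B ε • w = 0 := by
  obtain ⟨a, b, h⟩ := M.exists_sum ε hε
  let T : Fin m → (C ⊗[B] C →ₗ[B] C) := fun i =>
    (TensorProduct.lid B C).toLinearMap ∘ₗ (M.trace ∘ₗ LinearMap.mulLeft B (b i)).rTensor C
  let T' : Fin m → (S ⊗[R] S →ₗ[R] S) := fun i =>
    (TensorProduct.lid R S).toLinearMap ∘ₗ
      (E.τ ∘ₗ LinearMap.mulLeft R (algebraMap C S (b i))).rTensor S
  have h1 : ∀ i z, algebraMap C S (T i z) = T' i (tensorModelMap B C R S z) := fun i z => by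
    induction z with
    | zero => simp
    | tmul x y =>
      simp only [T, T', tensorModelMap_tmul, LinearMap.comp_apply, LinearEquiv.coe_coe,
        LinearMap.rTensor_tmul, TensorProduct.lid_tmul, LinearMap.mulLeft_apply]
      rw [Algebra.smul_def, map_mul, ← IsScalarTower.algebraMap_apply,
        IsScalarTower.algebraMap_apply B R S, M.algebraMap_trace, map_mul, Algebra.smul_def]
    | add x y hx hy => simp only [map_add, hx, hy]
  have h2 : ∀ z, algebraMap V B ε • z = ∑ i, a i ⊗ₜ[B] T i z := fun z => by
    induction z with
    | zero => simp
    | tmul x y =>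
      rw [TensorProduct.smul_tmul', ← M.sum_trace h x, TensorProduct.sum_tmul]
      exact Finset.sum_congr rfl fun i _ => by simp [T, TensorProduct.smul_tmul]
    | add x y hx hy =>
      simp only [smul_add, map_add, TensorProduct.tmul_add, Finset.sum_add_distrib, hx, hy]
  rw [h2]
  refine Finset.sum_eq_zero fun i _ => ?_
  have h3 : T i w = 0 := M.injective (by rw [h1, hw, map_zero, map_zero])
  rw [h3, TensorProduct.tmul_zero]

section Unramified

variable (E) in
/-- The relation "`z = ε e`" between `ε` and `z ∈ C ⊗ C`. The equality `z = ε e` in `S ⊗ S`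
determines `z` only up to almost zero elements; divisibility of `z` by some `t k` makes it unique. -/
def IsMultiple (C : Type v) [CommRing C] [Algebra B C] [Algebra C S] [IsScalarTower B C S]
    (t : ℕ → V) (ε : V) (z : C ⊗[B] C) : Prop :=
  ∃ k, ∃ w : C ⊗[B] C, z = algebraMap V B (t k) • w ∧
    algebraMap V B (t k) • tensorModelMap B C R S w = algebraMap V B ε • E.e

variable {t : ℕ → V}

theorem isMultiple_level (ht : ExhaustingSequence 𝔥 B R t) {ε : V} {z : C ⊗[B] C}
    (h : IsMultiple E C t ε z) : ∃ k, ∀ l, k ≤ l → ∃ w : C ⊗[B] C, z = algebraMap V B (t l) • w ∧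
      algebraMap V B (t l) • tensorModelMap B C R S w = algebraMap V B ε • E.e := by
  obtain ⟨k, w, rfl, hw⟩ := h
  refine ⟨k, fun l hkl => ?_⟩
  obtain ⟨d, hd⟩ := ht.dvd hkl
  rw [hd, map_mul, mul_smul] at hw ⊢
  exact ⟨_, rfl, by rw [map_smul, hw]⟩

theorem isMultiple_unique (M : AlmostModel 𝔥 B C E m) (ht : ExhaustingSequence 𝔥 B R t) {ε : V}
    {z z' : C ⊗[B] C} (h : IsMultiple E C t ε z) (h' : IsMultiple E C t ε z') : z = z' := by
  obtain ⟨k, hk⟩ := isMultiple_level ht h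
  obtain ⟨k', hk'⟩ := isMultiple_level ht h'
  obtain ⟨w, rfl, hw⟩ := hk _ (le_max_left k k')
  obtain ⟨w', rfl, hw'⟩ := hk' _ (le_max_right k k')
  rw [← sub_eq_zero, ← smul_sub]
  refine M.smul_eq_zero ?_ (ht.mem _)
  rw [← sub_eq_zero, ← hw', ← smul_sub, ← map_sub, ← algebraMap_smul R] at hw
  exact (ht.isUnit _).smul_eq_zero.mp hw

theorem exists_isMultiple (M : AlmostModel 𝔥 B C E m) (ht : ExhaustingSequence 𝔥 B R t) {ε : V}
    (hε : ε ∈ 𝔥) : ∃ z : C ⊗[B] C, IsMultiple E C t ε z := by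
  obtain ⟨k, η, h⟩ := ht.exists_eq_sq_mul ε hε
  obtain ⟨a, b, hab⟩ := M.exists_sum _ (ht.mem k)
  refine ⟨_, k, η • ∑ i, a i ⊗ₜ b i, rfl, ?_⟩
  rw [map_smul, map_sum, h]
  simp only [tensorModelMap_tmul]
  rw [← hab, algebraMap_smul R (algebraMap V B (t k)) E.e, smul_smul, smul_smul]
  congr 1
  ring

variable [Algebra V C] [IsScalarTower V B C]

/-- The almost element `ε ↦ ε e` of `C ⊗ C`. Its properties hold in `S ⊗ S` and lift to `C ⊗ C`,
since the values are divisible by some `t k`, which kills the kernel. -/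
theorem almostUnramified (M : AlmostModel 𝔥 B C E m) (ht : ExhaustingSequence 𝔥 B R t) :
    AlmostUnramified 𝔥 B C := by
  choose f hf using fun ε : 𝔥 => M.exists_isMultiple ht ε.2
  have hV : ∀ (v : V) (z : C ⊗[B] C), v • z = algebraMap V B v • z := fun v z =>
    (algebraMap_smul B v z).symm
  have hmem : ∀ k z, tensorModelMap B C R S z = 0 → algebraMap V B (t k) • z = 0 :=
    fun k z hz => M.smul_eq_zero hz (ht.mem k)
  have hcancel : ∀ (k) (z : S ⊗[R] S), algebraMap V B (t k) • z = 0 → z = 0 := fun k z hz => by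
    rw [← algebraMap_smul R] at hz
    exact (ht.isUnit _).smul_eq_zero.mp hz
  let e : 𝔥 →ₗ[V] C ⊗[B] C :=
    { toFun := f
      map_add' := fun ε δ => by
        refine M.isMultiple_unique ht (hf _) ?_
        obtain ⟨k, hk⟩ := isMultiple_level ht (hf ε)
        obtain ⟨k', hk'⟩ := isMultiple_level ht (hf δ)
        obtain ⟨w, h1, hw⟩ := hk _ (le_max_left k k')
        obtain ⟨w', h1', hw'⟩ := hk' _ (le_max_right k k')
        exact ⟨_, w + w', by rw [h1, h1', smul_add], by
          rw [map_add, smul_add, hw, hw', Submodule.coe_add, map_add, add_smul]⟩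
      map_smul' := fun v ε => by
        refine M.isMultiple_unique ht (hf _) ?_
        obtain ⟨k, w, h1, hw⟩ := hf ε
        refine ⟨k, algebraMap V B v • w, ?_, ?_⟩
        · rw [RingHom.id_apply, h1, hV, smul_comm]
        · rw [map_smul, smul_comm, hw, Submodule.coe_smul, smul_eq_mul, map_mul, mul_smul] }
  refine ⟨e, fun ε δ => ?_, fun ε => ?_, fun x hx ε δ => ?_⟩
  · refine M.isMultiple_unique ht ?_ (hf _)
    obtain ⟨k, hk⟩ := isMultiple_level ht (hf ε)
    obtain ⟨k', hk'⟩ := isMultiple_level ht (hf δ)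
    obtain ⟨w, h1, hw⟩ := hk _ (le_max_left k k')
    obtain ⟨w', h1', hw'⟩ := hk' _ (le_max_right k k')
    refine ⟨max k k', algebraMap V B (t (max k k')) • (w * w'), ?_, ?_⟩
    · change f ε * f δ = _
      rw [h1, h1', smul_mul_smul_comm, mul_smul]
    · rw [map_smul, map_mul, ← mul_smul, ← smul_mul_smul_comm, hw, hw', smul_mul_smul_comm,
        E.e_mul_self, ← map_mul]
      rfl
  · obtain ⟨k, w, h1, hw⟩ := hf ε
    apply M.injective
    change algebraMap C S (Algebra.TensorProduct.lmul' B (f ε)) = _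
    rw [← lmul'_tensorModelMap (R := R), h1, map_smul, hw, ← algebraMap_smul R, map_smul, E.lmul_e,
      IsScalarTower.algebraMap_apply V B C, ← IsScalarTower.algebraMap_apply B C S,
      IsScalarTower.algebraMap_apply B R S, Algebra.smul_def, mul_one]
  · obtain ⟨k, w, h1, hw⟩ := hf δ
    change x ε * f δ = 0
    rw [h1, mul_smul_comm]
    refine hmem k _ (hcancel k _ ?_)
    rw [map_mul, ← mul_smul_comm, hw, mul_smul_comm, E.mul_e_eq_zero, smul_zero]
    rw [lmul'_tensorModelMap, hx, map_zero]

theorem almostFiniteEtale (M : AlmostModel 𝔥 B C E m) (ht : ExhaustingSequence 𝔥 B R t) :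
    AlmostFiniteEtale 𝔥 B C where
  unramified := M.almostUnramified ht
  flat := M.isAlmostSummand.almostFlat
  fp := M.isAlmostSummand.almostFP

end Unramified

end AlmostModel

end AlmostEtale

/-! ### Power-bounded elements of Banach algebras -/

section Base

variable {A ι : Type*} [CommRing A]

/-- The properties of the tilt and of a pseudo-uniformizer that enter the proof: `A` is a perfect
ring in which `p` vanishes, and the absolute values of `ϖ` have the common value `r ∈ (0, 1)`. -/
structure IsPerfectBase (p : ℕ) (V : AbsFamily A ι) (ϖ : A) (r : ℝ) : Prop where
  natCast_eq_zero : (p : A) = 0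
  exists_pow_eq (x : A) : ∃ y, y ^ p = x
  pos : 0 < r
  lt_one : r < 1
  abs_eq (s : ι) : (V.abs s ϖ : ℝ) = r

variable {p : ℕ} {V : AbsFamily A ι} {ϖ : A} {r : ℝ}

/-- A compatible system `π k = ϖ ^ (1 / p ^ k)` of roots. -/
theorem IsPerfectBase.exists_roots (h : IsPerfectBase p V ϖ r) :
    ∃ π : ℕ → A, π 0 = ϖ ∧ ∀ k j, π (k + j) ^ p ^ j = π k := by
  choose f hf using h.exists_pow_eq
  refine ⟨fun k => f^[k] ϖ, rfl, fun k j => ?_⟩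
  induction j with
  | zero => simp
  | succ j ih =>
    change f^[k + j + 1] ϖ ^ p ^ (j + 1) = f^[k] ϖ
    rw [Function.iterate_succ_apply', pow_succ', pow_mul, hf]
    exact ih

theorem IsPerfectBase.abs_root (hp : p.Prime) (h : IsPerfectBase p V ϖ r) {k : ℕ} {a : A}
    (ha : a ^ p ^ k = ϖ) (s : ι) : (V.abs s a : ℝ) = r ^ (((p ^ k : ℕ) : ℝ)⁻¹) := by
  rw [← h.abs_eq s, ← ha, map_pow, NNReal.coe_pow,
    Real.pow_rpow_inv_natCast (NNReal.coe_nonneg _) (pow_ne_zero _ hp.ne_zero)]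

end Base

namespace BanachAlgebra

variable {A ι : Type*} [CommRing A] {V : AbsFamily A ι} {K R : Type*} [CommRing K] [CommRing R]
  [Algebra A K] [Algebra K R] (N : BanachAlgebra V K R)

theorem nrm_sum_le (s : ι) {κ : Type*} (t : Finset κ) (f : κ → R) {c : ℝ} (hc : 0 ≤ c)
    (h : ∀ i ∈ t, N.nrm s (f i) ≤ c) : N.nrm s (∑ i ∈ t, f i) ≤ c := by
  classical
  induction t using Finset.induction_on with
  | empty => simpa [N.nrm_zero] using hc
  | insert i t hi ih =>
    rw [Finset.sum_insert hi]
    exact (N.add_le _ _ _).trans (max_le (h i (Finset.mem_insert_self i t))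
      (ih fun j hj => h j (Finset.mem_insert_of_mem hj)))

theorem norm_sum_le {κ : Type*} (t : Finset κ) (f : κ → R) {c : ℝ} (hc : 0 ≤ c)
    (h : ∀ i ∈ t, N.norm (f i) ≤ c) : N.norm (∑ i ∈ t, f i) ≤ c :=
  Real.iSup_le (fun s => N.nrm_sum_le s t f hc fun i hi => (N.nrm_le_norm s _).trans (h i hi)) hc

theorem norm_pow_succ_le (x : R) (n : ℕ) : N.norm (x ^ (n + 1)) ≤ N.norm x ^ (n + 1) := by
  induction n with
  | zero => simp
  | succ n ih =>
    rw [pow_succ, pow_succ (N.norm x)]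
    exact (N.norm_mul_le _ _).trans (mul_le_mul_of_nonneg_right ih (N.norm_nonneg x))

theorem eq_zero_of_norm_le_zero {x : R} (h : N.norm x ≤ 0) : x = 0 :=
  N.separated x fun s => le_antisymm ((N.nrm_le_norm s x).trans h) (N.nonneg s x)

variable [Algebra A R] [IsScalarTower A K R]

theorem nrm_map_mul (s : ι) (a : A) (x : R) :
    N.nrm s (algebraMap A R a * x) = V.abs s a * N.nrm s x := by
  have h := N.smul s a 1 (algebraMap A K a) x (by simp)
  rwa [map_one, NNReal.coe_one, one_mul, algebraMap_smul, Algebra.smul_def] at h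

theorem norm_map_mul {a : A} {c : ℝ} (hc : 0 ≤ c) (ha : ∀ s, (V.abs s a : ℝ) = c) (x : R) :
    N.norm (algebraMap A R a * x) = c * N.norm x := by
  simp only [norm, nrm_map_mul, ha]
  exact (Real.mul_iSup_of_nonneg hc _).symm

theorem norm_map_pow_mul {a : A} {c : ℝ} (hc : 0 ≤ c) (ha : ∀ s, (V.abs s a : ℝ) = c) (n : ℕ)
    (x : R) : N.norm (algebraMap A R a ^ n * x) = c ^ n * N.norm x := by
  rw [← map_pow]
  exact N.norm_map_mul (pow_nonneg hc n) (fun s => by simp [ha]) x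

theorem mem_powerBounded_of_norm_le_one {x : R} (hx : N.norm x ≤ 1) : x ∈ N.powerBounded := by
  refine ⟨max (N.norm 1) 1, fun n => ?_⟩
  cases n with
  | zero => simp
  | succ n =>
    exact (N.norm_pow_succ_le x n).trans
      ((pow_le_one₀ (N.norm_nonneg x) hx).trans (le_max_right _ _))

theorem mem_powerBounded_of_pow {x : R} {n : ℕ} (hn : n ≠ 0) (hx : x ^ n ∈ N.powerBounded) :
    x ∈ N.powerBounded := by
  obtain ⟨c, hc⟩ := hx
  refine ⟨c * ∑ j ∈ Finset.range n, N.norm (x ^ j), fun k => ?_⟩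
  rw [← Nat.div_add_mod k n, pow_add, pow_mul]
  refine (N.norm_mul_le _ _).trans (mul_le_mul (hc _) ?_ (N.norm_nonneg _)
    ((N.norm_nonneg _).trans (hc 0)))
  exact Finset.single_le_sum (f := fun j => N.norm (x ^ j)) (fun j _ => N.norm_nonneg _)
    (Finset.mem_range.mpr (Nat.mod_lt k (Nat.pos_of_ne_zero hn)))

/-- The subring of power-bounded elements contains the closed unit ball. -/
theorem isOpen_powerBounded : @IsOpen R N.topology (N.powerBounded : Set R) := by
  let _ := N.addGroupNorm.toNormedAddCommGroup
  refine AddSubgroup.isOpen_of_mem_nhds N.powerBounded.toSubring.toAddSubgroup (g := 0) ?_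
  refine Filter.mem_of_superset (Metric.ball_mem_nhds 0 one_pos) fun x hx => ?_
  rw [mem_ball_zero_iff] at hx
  exact N.mem_powerBounded_of_norm_le_one (le_of_lt hx)

section Uniformizer

variable {p : ℕ} {ϖ : A} {r : ℝ}

theorem exists_pow_mul_mem (h : IsPerfectBase p V ϖ r) (x : R) :
    ∃ n, algebraMap A R ϖ ^ n * x ∈ N.powerBounded := by
  have h1 := (tendsto_pow_atTop_nhds_zero_of_lt_one h.pos.le h.lt_one).mul_const (N.norm x)
  rw [zero_mul] at h1
  obtain ⟨n, hn⟩ := (h1.eventually (gt_mem_nhds one_pos)).exists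
  refine ⟨n, N.mem_powerBounded_of_norm_le_one ?_⟩
  rw [N.norm_map_pow_mul h.pos.le h.abs_eq]
  exact hn.le

/-- Finitely many elements are multiplied into `R°` by one power of `ϖ`. -/
theorem exists_pow_mul_mem_fin (h : IsPerfectBase p V ϖ r) {m : ℕ} (x : Fin m → R) :
    ∃ n, ∀ i, algebraMap A R ϖ ^ n * x i ∈ N.powerBounded := by
  choose n hn using fun i => N.exists_pow_mul_mem h (x i)
  refine ⟨∑ i, n i, fun i => ?_⟩
  obtain ⟨k, hk⟩ := Nat.exists_eq_add_of_le'
    (Finset.single_le_sum (f := n) (fun _ _ => Nat.zero_le _) (Finset.mem_univ i))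
  rw [hk, pow_add, mul_assoc, ← map_pow]
  exact N.powerBounded.mul_mem (N.powerBounded.algebraMap_mem _) (hn i)

theorem isReduced (h : IsPerfectBase p V ϖ r) (hu : IsUnit (algebraMap A R ϖ))
    (hb : ∃ c : ℝ, ∀ x ∈ N.powerBounded, N.norm x ≤ c) : IsReduced R := by
  obtain ⟨c, hb⟩ := hb
  obtain ⟨w, hw⟩ := hu.exists_right_inv
  refine (isReduced_iff_pow_one_lt 2 one_lt_two).mpr fun x hx => ?_
  -- all multiples `ϖ⁻ⁿ x` have square zero, so they are power-bounded
  have h1 : ∀ n : ℕ, N.norm x ≤ r ^ n * c := fun n => by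
    have h2 : w ^ n * x ∈ N.powerBounded := by
      refine N.mem_powerBounded_of_pow two_ne_zero ?_
      rw [mul_pow, hx, mul_zero]
      exact N.powerBounded.zero_mem
    have h3 : x = algebraMap A R ϖ ^ n * (w ^ n * x) := by
      rw [← mul_assoc, ← mul_pow, hw, one_pow, one_mul]
    calc N.norm x = r ^ n * N.norm (w ^ n * x) := by
          conv_lhs => rw [h3, N.norm_map_pow_mul h.pos.le h.abs_eq]
      _ ≤ r ^ n * c := mul_le_mul_of_nonneg_left (hb _ h2) (pow_nonneg h.pos.le n)
  have h4 := (tendsto_pow_atTop_nhds_zero_of_lt_one h.pos.le h.lt_one).mul_const c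
  rw [zero_mul] at h4
  exact N.eq_zero_of_norm_le_zero (ge_of_tendsto' h4 h1)

/-- In a perfectoid algebra the partial sums `∑ ϖ^(i/p) yᵢ`, where `∑ ϖ^i yᵢ ^ p` is an expansion of
`x`, converge to a `p`-th root of `x`. -/
theorem exists_pow_eq [hp : Fact p.Prime] (h : IsPerfectBase p V ϖ r)
    (hu : IsUnit (algebraMap A R ϖ)) (hN : N.IsPerfectoid p ϖ) (x : R) : ∃ y, y ^ p = x := by
  obtain ⟨π, hπ⟩ := h.exists_pow_eq ϖ
  have hR : (p : R) = 0 := natCast_eq_zero_of_algebra A h.natCast_eq_zero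
  have hπR : algebraMap A R π ^ p = algebraMap A R ϖ := by rw [← map_pow, hπ]
  obtain ⟨ρ, hρ⟩ : ∃ ρ : ℝ, ρ = r ^ (((p ^ 1 : ℕ) : ℝ)⁻¹) := ⟨_, rfl⟩
  have hρ0 : 0 ≤ ρ := hρ ▸ Real.rpow_nonneg h.pos.le _
  have hρ1 : ρ < 1 := hρ ▸ Real.rpow_lt_one h.pos.le h.lt_one
    (inv_pos.mpr (Nat.cast_pos.mpr (pow_pos hp.1.pos 1)))
  have hπabs : ∀ s, (V.abs s π : ℝ) = ρ := fun s => by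
    rw [hρ]; exact h.abs_root hp.1 (by rw [pow_one, hπ]) s
  obtain ⟨c, hc⟩ := hN.bounded
  have hc0 : 0 ≤ c := (N.norm_nonneg 0).trans (hc 0 N.powerBounded.zero_mem)
  suffices H : ∀ x : N.powerBounded, ∃ y : R, y ^ p = x by
    obtain ⟨n, hn⟩ := N.exists_pow_mul_mem h x
    obtain ⟨y, hy⟩ := H ⟨_, hn⟩
    have hπu : IsUnit (algebraMap A R π) := by
      rw [← hπR] at hu
      exact (isUnit_pow_iff hp.1.ne_zero).mp hu
    obtain ⟨w, hw⟩ := hπu.exists_left_inv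
    refine ⟨w ^ n * y, ?_⟩
    rw [mul_pow, hy]
    change (w ^ n) ^ p * (algebraMap A R ϖ ^ n * x) = x
    rw [← hπR]
    have h1 : (w ^ n) ^ p * ((algebraMap A R π ^ p) ^ n * x) =
        (w * algebraMap A R π) ^ (n * p) * x := by ring
    rw [h1, hw, one_pow, one_mul]
  intro x
  choose Y Z hZ using hN.frobenius
  have hYZ : ∀ z : N.powerBounded, (Y z : R) ^ p + algebraMap A R ϖ * Z z = z := fun z => by
    have := congrArg (Subtype.val) (hZ z)
    change (z : R) - (Y z : R) ^ p = algebraMap A R ϖ * Z z at this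
    rw [← this, add_sub_cancel]
  let z : ℕ → N.powerBounded := fun n => Z^[n] x
  let u : ℕ → R := fun n => ∑ i ∈ Finset.range n, algebraMap A R π ^ i * (Y (z i) : R)
  have hu1 : ∀ n, u n ^ p + algebraMap A R ϖ ^ n * (z n : R) = x := fun n => by
    have h1 := sum_pow_prime_pow hR 1 (Finset.range n)
      fun i => algebraMap A R π ^ i * (Y (z i) : R)
    simp only [pow_one] at h1
    rw [h1]
    clear h1
    induction n with
    | zero => simp [z]
    | succ n ih =>
      have hz : z (n + 1) = Z (z n) := Function.iterate_succ_apply' Z n x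
      conv_rhs => rw [← ih]
      rw [Finset.sum_range_succ, hz, mul_pow, ← pow_mul, mul_comm n p, pow_mul, hπR]
      conv_rhs => rw [← hYZ (z n)]
      ring
  have hcauchy : ∀ n m, N.norm (u (n + m) - u n) ≤ ρ ^ n * c := fun n m => by
    simp only [u, Finset.sum_range_add, add_sub_cancel_left]
    refine N.norm_sum_le _ _ (by positivity) fun i _ => ?_
    rw [N.norm_map_pow_mul hρ0 hπabs]
    exact mul_le_mul (pow_le_pow_of_le_one hρ0 hρ1.le (Nat.le_add_right n i)) (hc _ (Y _).2)
      (N.norm_nonneg _) (by positivity)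
  have hlim : ∀ (q : ℝ), 0 ≤ q → q < 1 → ∀ ε : ℝ, 0 < ε → ∃ n, ∀ m ≥ n, q ^ m * c < ε :=
    fun q hq hq1 ε hε => by
      have h1 := (tendsto_pow_atTop_nhds_zero_of_lt_one hq hq1).mul_const c
      rw [zero_mul] at h1
      exact Filter.eventually_atTop.mp (h1.eventually (gt_mem_nhds hε))
  obtain ⟨l, hl⟩ := N.complete u fun ε hε => by
    obtain ⟨n, hn⟩ := hlim ρ hρ0 hρ1 ε hε
    have h1 : ∀ m, N.norm (u (n + m) - u n) < ε := fun m =>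
      (hcauchy n m).trans_lt (hn n le_rfl)
    refine ⟨n, fun a ha b hb => ?_⟩
    obtain ⟨a, rfl⟩ := Nat.exists_eq_add_of_le ha
    obtain ⟨b, rfl⟩ := Nat.exists_eq_add_of_le hb
    have h2 : u (n + a) - u (n + b) = (u (n + a) - u n) + -(u (n + b) - u n) := by ring
    change N.norm _ < ε
    rw [h2]
    refine (N.norm_add_le_max _ _).trans_lt (max_lt (h1 a) ?_)
    rw [N.norm_neg]
    exact h1 b
  refine ⟨l, sub_eq_zero.mp (N.eq_zero_of_norm_le_zero (le_of_forall_pos_lt_add ?_))⟩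
  intro ε hε
  rw [zero_add]
  obtain ⟨n₁, hn₁⟩ := hl (min ε 1) (lt_min hε one_pos)
  obtain ⟨n₂, hn₂⟩ := hlim r h.pos.le h.lt_one ε hε
  set n := max n₁ n₂
  have h1 : N.norm (u n - l) < min ε 1 := hn₁ n (le_max_left _ _)
  have h2 : l ^ p - x = -((u n - l) ^ p) + -(algebraMap A R ϖ ^ n * (z n : R)) := by
    have := sub_pow_prime_pow hR 1 (u n) l
    rw [pow_one] at this
    rw [this, ← hu1 n]
    ring
  rw [h2]
  refine (N.norm_add_le_max _ _).trans_lt ?_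
  rw [N.norm_neg, N.norm_neg]
  refine max_lt ?_ ?_
  · obtain ⟨q, hq⟩ := Nat.exists_eq_succ_of_ne_zero hp.1.ne_zero
    rw [hq]
    refine (N.norm_pow_succ_le _ _).trans_lt (lt_of_le_of_lt ?_ (h1.trans_le (min_le_left _ _)))
    exact pow_le_of_le_one (N.norm_nonneg _) (h1.le.trans (min_le_right _ _)) (Nat.succ_ne_zero q)
  · rw [N.norm_map_pow_mul h.pos.le h.abs_eq]
    exact (mul_le_mul_of_nonneg_left (hc _ (z n).2) (pow_nonneg h.pos.le n)).trans_lt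
      (hn₂ n (le_max_right _ _))

/-- If the powers `t ^ p ^ k` are bounded, then `ϖ ^ (n / p ^ k) t` is power-bounded for a fixed `n`
and all `k`, and boundedness of `R°` gives a bound on all powers of `t`. -/
theorem mem_powerBounded_of_pow_prime_pow (hp : p.Prime) (h : IsPerfectBase p V ϖ r)
    (hb : ∃ c : ℝ, ∀ x ∈ N.powerBounded, N.norm x ≤ c) {t : R} {C : ℝ}
    (ht : ∀ k : ℕ, N.norm (t ^ p ^ k) ≤ C) : t ∈ N.powerBounded := by
  obtain ⟨c, hb⟩ := hb
  obtain ⟨π, hπ0, hπ⟩ := h.exists_roots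
  have h1 := (tendsto_pow_atTop_nhds_zero_of_lt_one h.pos.le h.lt_one).mul_const C
  rw [zero_mul] at h1
  obtain ⟨n, hn⟩ := (h1.eventually (gt_mem_nhds one_pos)).exists
  have hπ' : ∀ k, π k ^ p ^ k = ϖ := fun k => by simpa [hπ0] using hπ 0 k
  have hmem : ∀ k, algebraMap A R (π k) ^ n * t ∈ N.powerBounded := fun k => by
    refine N.mem_powerBounded_of_pow (pow_ne_zero k hp.ne_zero) ?_
    rw [mul_pow, ← pow_mul, mul_comm n, pow_mul, ← map_pow, hπ']
    refine N.mem_powerBounded_of_norm_le_one ?_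
    rw [N.norm_map_pow_mul h.pos.le h.abs_eq]
    exact (mul_le_mul_of_nonneg_left (ht k) (pow_nonneg h.pos.le n)).trans hn.le
  refine ⟨c, fun j => ?_⟩
  have hle : ∀ k : ℕ, (r ^ (((p ^ k : ℕ) : ℝ)⁻¹)) ^ (n * j) * N.norm (t ^ j) ≤ c := fun k => by
    rw [← N.norm_map_pow_mul (Real.rpow_nonneg h.pos.le _) (h.abs_root hp (hπ' k)), pow_mul,
      ← mul_pow]
    exact hb _ (N.powerBounded.pow_mem (hmem k) j)
  have hlim : Filter.Tendsto
      (fun k : ℕ => (r ^ (((p ^ k : ℕ) : ℝ)⁻¹)) ^ (n * j) * N.norm (t ^ j)) Filter.atTop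
      (nhds (1 * N.norm (t ^ j))) := by
    refine Filter.Tendsto.mul_const _ ?_
    have h2 : Filter.Tendsto (fun k : ℕ => (((p ^ k : ℕ) : ℝ)⁻¹)) Filter.atTop (nhds 0) :=
      tendsto_inv_atTop_zero.comp
        (tendsto_natCast_atTop_atTop.comp (tendsto_pow_atTop_atTop_of_one_lt hp.one_lt))
    have h3 := ((Real.continuousAt_const_rpow h.pos.ne').tendsto.comp h2).pow (n * j)
    simpa using h3
  rw [one_mul] at hlim
  exact le_of_tendsto' hlim hle

/-- An element of `𝔥` has absolute values at most `ρ < 1`, hence at most `|ϖ| ^ (1 / p ^ k)` for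
large `k`. -/
theorem exists_eq_root_mul (hp : p.Prime) (h : IsPerfectBase p V ϖ r)
    (hu : IsUnit (algebraMap A R ϖ)) {π : ℕ → A} (hπ : ∀ k, π k ^ p ^ k = ϖ) {ε : A}
    (hε : ε ∈ V.𝔥) :
    ∃ k, ∃ η ∈ N.powerBounded, algebraMap A R ε = algebraMap A R (π k) * η := by
  have hε' : V.norm ε < 1 := hε
  have h1 := (tendsto_pow_atTop_nhds_zero_of_lt_one (V.norm_nonneg ε) hε').comp
    (tendsto_pow_atTop_atTop_of_one_lt hp.one_lt)
  obtain ⟨k, hk⟩ := (h1.eventually (gt_mem_nhds h.pos)).exists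
  have hπu : IsUnit (algebraMap A R (π k)) := by
    rw [← hπ k, map_pow] at hu
    exact (isUnit_pow_iff (pow_ne_zero k hp.ne_zero)).mp hu
  obtain ⟨w, hw⟩ := hπu.exists_right_inv
  refine ⟨k, w * algebraMap A R ε, ⟨N.norm 1, fun n => ?_⟩, by rw [← mul_assoc, hw, one_mul]⟩
  refine Real.iSup_le (fun s => ?_) (N.norm_nonneg 1)
  have h2 : N.nrm s (algebraMap A R (π k ^ n) * (w * algebraMap A R ε) ^ n) =
      N.nrm s (algebraMap A R (ε ^ n) * 1) := by
    rw [map_pow, ← mul_pow, ← mul_assoc, hw, one_mul, map_pow, mul_one]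
  rw [N.nrm_map_mul, N.nrm_map_mul, map_pow, map_pow, NNReal.coe_pow, NNReal.coe_pow] at h2
  have h3 : (V.abs s (π k) : ℝ) ^ p ^ k = r := by
    rw [← h.abs_eq s, ← hπ k, map_pow, NNReal.coe_pow]
  have h4 : (V.abs s ε : ℝ) ≤ V.abs s (π k) := by
    refine le_of_pow_le_pow_left₀ (pow_ne_zero k hp.ne_zero) (NNReal.coe_nonneg _) ?_
    rw [h3]
    exact (pow_le_pow_left₀ (NNReal.coe_nonneg _) (V.abs_le_norm s ε) _).trans (le_of_lt hk)
  have h5 : (0 : ℝ) < V.abs s (π k) := by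
    refine lt_of_le_of_ne (NNReal.coe_nonneg _) fun h0 => h.pos.ne' ?_
    rw [← h3, ← h0, zero_pow (pow_ne_zero k hp.ne_zero)]
  refine le_of_mul_le_mul_left (h2.le.trans ?_) (pow_pos h5 n)
  exact mul_le_mul (pow_le_pow_left₀ (NNReal.coe_nonneg _) h4 n) (N.nrm_le_norm s 1)
    (N.nonneg s 1) (pow_nonneg h5.le n)

end Uniformizer

end BanachAlgebra

/-! ### Operator norms on a finite projective algebra -/

namespace BanachAlgebra

variable {A ι : Type*} [CommRing A] {V : AbsFamily A ι} {K R S : Type*} [CommRing K] [CommRing R]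
  [CommRing S] [Algebra A K] [Algebra K R] [Algebra R S]
  (N : BanachAlgebra V K R) (b : DualBasis R S)

/-- The maximum of the norms of the coordinates. -/
noncomputable def coordNrm (s : ι) (y : S) : ℝ := ⨆ i, N.nrm s (b.coord i y)

theorem coordNrm_nonneg (s : ι) (y : S) : 0 ≤ N.coordNrm b s y :=
  Real.iSup_nonneg fun _ => N.nonneg _ _

theorem nrm_coord_le (s : ι) (i : Fin b.n) (y : S) : N.nrm s (b.coord i y) ≤ N.coordNrm b s y :=
  le_ciSup (f := fun i => N.nrm s (b.coord i y)) (Set.finite_range _).bddAbove i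

theorem coordNrm_add_le (s : ι) (x y : S) :
    N.coordNrm b s (x + y) ≤ max (N.coordNrm b s x) (N.coordNrm b s y) :=
  Real.iSup_le (fun i => by
    rw [map_add]
    exact (N.add_le s _ _).trans (max_le_max (N.nrm_coord_le b s i x) (N.nrm_coord_le b s i y)))
    (le_max_of_le_left (N.coordNrm_nonneg b s x))

theorem coordNrm_smul_le (s : ι) (r : R) (y : S) :
    N.coordNrm b s (r • y) ≤ N.nrm s r * N.coordNrm b s y :=
  Real.iSup_le (fun i => by
    rw [map_smul, smul_eq_mul]
    exact (N.mul_le s _ _).trans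
      (mul_le_mul_of_nonneg_left (N.nrm_coord_le b s i y) (N.nonneg s r)))
    (mul_nonneg (N.nonneg s r) (N.coordNrm_nonneg b s y))

theorem coordNrm_le_sum (s : ι) (x : S) :
    N.coordNrm b s x ≤ ∑ i, N.norm (b.coord i x) :=
  Real.iSup_le (fun i => (N.nrm_le_norm s _).trans (Finset.single_le_sum
    (f := fun i => N.norm (b.coord i x)) (fun _ _ => N.norm_nonneg _) (Finset.mem_univ i)))
    (Finset.sum_nonneg fun _ _ => N.norm_nonneg _)

/-- A bound for the structure constants of the multiplication of `S`, uniform in `s`. -/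
noncomputable def mulBound : ℝ :=
  ∑ t : Fin b.n × Fin b.n × Fin b.n, N.norm (b.coord t.1 (b.vec t.2.1 * b.vec t.2.2))

theorem mulBound_nonneg : 0 ≤ N.mulBound b := Finset.sum_nonneg fun _ _ => N.norm_nonneg _

theorem coordNrm_mul_le (s : ι) (x y : S) :
    N.coordNrm b s (x * y) ≤ N.mulBound b * N.coordNrm b s x * N.coordNrm b s y := by
  have hD := N.mulBound_nonneg b
  have h0 : 0 ≤ N.mulBound b * N.coordNrm b s x * N.coordNrm b s y :=
    mul_nonneg (mul_nonneg hD (N.coordNrm_nonneg b s x)) (N.coordNrm_nonneg b s y)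
  refine Real.iSup_le (fun i => ?_) h0
  have h1 : b.coord i (x * y) = ∑ j, ∑ k,
      b.coord i (b.vec j * b.vec k) * b.coord j x * b.coord k y := by
    conv_lhs => rw [← b.sum_coord_smul x, ← b.sum_coord_smul y, Finset.sum_mul_sum]
    simp only [map_sum, smul_mul_smul_comm, map_smul, smul_eq_mul]
    exact Finset.sum_congr rfl fun j _ => Finset.sum_congr rfl fun k _ => by ring
  rw [h1]
  refine N.nrm_sum_le s _ _ h0 fun j _ => N.nrm_sum_le s _ _ h0 fun k _ => ?_
  have h2 : N.nrm s (b.coord i (b.vec j * b.vec k)) ≤ N.mulBound b :=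
    (N.nrm_le_norm s _).trans (Finset.single_le_sum
      (f := fun t : Fin b.n × Fin b.n × Fin b.n =>
        N.norm (b.coord t.1 (b.vec t.2.1 * b.vec t.2.2)))
      (fun _ _ => N.norm_nonneg _) (Finset.mem_univ (i, j, k)))
  refine (N.mul_le s _ _).trans (mul_le_mul ((N.mul_le s _ _).trans ?_) (N.nrm_coord_le b s k y)
    (N.nonneg _ _) (mul_nonneg hD (N.coordNrm_nonneg b s x)))
  exact mul_le_mul h2 (N.nrm_coord_le b s j x) (N.nonneg _ _) hD

/-- The operator norm of multiplication by `x`, with respect to `coordNrm`. -/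
noncomputable def opNrm (s : ι) (x : S) : ℝ := ⨆ y, N.coordNrm b s (x * y) / N.coordNrm b s y

theorem opNrm_nonneg (s : ι) (x : S) : 0 ≤ N.opNrm b s x :=
  Real.iSup_nonneg fun _ => div_nonneg (N.coordNrm_nonneg b s _) (N.coordNrm_nonneg b s _)

theorem opNrm_le {s : ι} {x : S} {c : ℝ} (hc : 0 ≤ c)
    (h : ∀ y, N.coordNrm b s (x * y) ≤ c * N.coordNrm b s y) : N.opNrm b s x ≤ c :=
  Real.iSup_le (fun y => div_le_of_le_mul₀ (N.coordNrm_nonneg b s y) hc (h y)) hc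

theorem opNrm_le_coordNrm (s : ι) (x : S) :
    N.opNrm b s x ≤ N.mulBound b * N.coordNrm b s x :=
  N.opNrm_le b (mul_nonneg (N.mulBound_nonneg b) (N.coordNrm_nonneg b s x))
    (N.coordNrm_mul_le b s x)

theorem div_le_opNrm (s : ι) (x y : S) :
    N.coordNrm b s (x * y) / N.coordNrm b s y ≤ N.opNrm b s x := by
  refine le_ciSup (f := fun y => N.coordNrm b s (x * y) / N.coordNrm b s y) ?_ y
  refine ⟨N.mulBound b * N.coordNrm b s x, ?_⟩
  rintro _ ⟨y, rfl⟩
  exact div_le_of_le_mul₀ (N.coordNrm_nonneg b s y)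
    (mul_nonneg (N.mulBound_nonneg b) (N.coordNrm_nonneg b s x)) (N.coordNrm_mul_le b s x y)

theorem coordNrm_mul_le_opNrm (s : ι) (x y : S) :
    N.coordNrm b s (x * y) ≤ N.opNrm b s x * N.coordNrm b s y := by
  rcases (N.coordNrm_nonneg b s y).eq_or_lt with h | h
  · have h1 := N.coordNrm_mul_le b s x y
    rw [← h, mul_zero] at h1 ⊢
    exact h1
  · exact (div_le_iff₀ h).mp (N.div_le_opNrm b s x y)

theorem nrm_coord_le_opNrm (s : ι) (i : Fin b.n) (x : S) :
    N.nrm s (b.coord i x) ≤ N.opNrm b s x * N.coordNrm b s 1 := by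
  refine (N.nrm_coord_le b s i x).trans ?_
  simpa using N.coordNrm_mul_le_opNrm b s x 1

theorem opNrm_add_le (s : ι) (x y : S) :
    N.opNrm b s (x + y) ≤ max (N.opNrm b s x) (N.opNrm b s y) := by
  refine N.opNrm_le b (le_max_of_le_left (N.opNrm_nonneg b s x)) fun z => ?_
  rw [add_mul, max_mul_of_nonneg _ _ (N.coordNrm_nonneg b s z)]
  exact (N.coordNrm_add_le b s _ _).trans
    (max_le_max (N.coordNrm_mul_le_opNrm b s x z) (N.coordNrm_mul_le_opNrm b s y z))

theorem opNrm_mul_le (s : ι) (x y : S) :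
    N.opNrm b s (x * y) ≤ N.opNrm b s x * N.opNrm b s y := by
  refine N.opNrm_le b (mul_nonneg (N.opNrm_nonneg b s x) (N.opNrm_nonneg b s y)) fun z => ?_
  rw [mul_assoc, mul_assoc]
  exact (N.coordNrm_mul_le_opNrm b s x _).trans
    (mul_le_mul_of_nonneg_left (N.coordNrm_mul_le_opNrm b s y z) (N.opNrm_nonneg b s x))

theorem opNrm_smul_le (s : ι) (r : R) (x : S) :
    N.opNrm b s (r • x) ≤ N.nrm s r * N.opNrm b s x := by
  refine N.opNrm_le b (mul_nonneg (N.nonneg s r) (N.opNrm_nonneg b s x)) fun z => ?_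
  rw [smul_mul_assoc, mul_assoc]
  exact (N.coordNrm_smul_le b s r _).trans
    (mul_le_mul_of_nonneg_left (N.coordNrm_mul_le_opNrm b s x z) (N.nonneg s r))

theorem opNrm_one {s : ι} {y : S} (h : N.coordNrm b s y ≠ 0) : N.opNrm b s 1 = 1 := by
  refine le_antisymm (N.opNrm_le b zero_le_one fun y => by simp) ?_
  simpa [div_self h] using N.div_le_opNrm b s 1 y

theorem bddAbove_opNrm (x : S) : BddAbove (Set.range fun s => N.opNrm b s x) := by
  refine ⟨N.mulBound b * ∑ i, N.norm (b.coord i x), ?_⟩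
  rintro _ ⟨s, rfl⟩
  exact (N.opNrm_le_coordNrm b s x).trans
    (mul_le_mul_of_nonneg_left (N.coordNrm_le_sum b s x) (N.mulBound_nonneg b))

theorem norm_coord_le_iSup_opNrm (i : Fin b.n) (x : S) : N.norm (b.coord i x) ≤
    (∑ j, N.norm (b.coord j 1)) * ⨆ s, N.opNrm b s x := by
  have h0 : 0 ≤ ⨆ s, N.opNrm b s x := Real.iSup_nonneg fun s => N.opNrm_nonneg b s x
  refine Real.iSup_le (fun s => ?_) (mul_nonneg (Finset.sum_nonneg fun _ _ => N.norm_nonneg _) h0)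
  rw [mul_comm]
  exact (N.nrm_coord_le_opNrm b s i x).trans (mul_le_mul (le_ciSup (N.bddAbove_opNrm b x) s)
    (N.coordNrm_le_sum b s 1) (N.coordNrm_nonneg b s 1) h0)

/-- Completeness of `S`: the coordinates of a Cauchy sequence converge in `R`. -/
theorem opNrm_complete (u : ℕ → S)
    (hu : ∀ ε : ℝ, 0 < ε → ∃ n, ∀ m ≥ n, ∀ k ≥ n, (⨆ s, N.opNrm b s (u m - u k)) < ε) :
    ∃ x, ∀ ε : ℝ, 0 < ε → ∃ n, ∀ k ≥ n, (⨆ s, N.opNrm b s (u k - x)) < ε := by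
  have hlim : ∀ i, ∃ l, ∀ ε : ℝ, 0 < ε → ∃ n, ∀ k ≥ n, N.norm (b.coord i (u k) - l) < ε :=
    fun i => N.complete (fun k => b.coord i (u k)) fun ε hε => by
      have hc : 0 ≤ ∑ j, N.norm (b.coord j 1) := Finset.sum_nonneg fun _ _ => N.norm_nonneg _
      obtain ⟨n, hn⟩ := hu (ε / (1 + ∑ j, N.norm (b.coord j 1))) (by positivity)
      refine ⟨n, fun m hm k hk => ?_⟩
      rw [← map_sub]
      refine (N.norm_coord_le_iSup_opNrm b i _).trans_lt ?_
      have h1 := (lt_div_iff₀ (by positivity)).mp (hn m hm k hk)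
      have h2 : 0 ≤ ⨆ s, N.opNrm b s (u m - u k) := Real.iSup_nonneg fun s => N.opNrm_nonneg b s _
      linarith
  choose l hl using hlim
  refine ⟨∑ i, l i • b.vec i, fun ε hε => ?_⟩
  have hE0 : 0 ≤ ∑ i, ⨆ s, N.opNrm b s (b.vec i) :=
    Finset.sum_nonneg fun _ _ => Real.iSup_nonneg fun s => N.opNrm_nonneg b s _
  set E := 1 + ∑ i, ⨆ s, N.opNrm b s (b.vec i) with hE
  have hE1 : 0 < E := by positivity
  choose n hn using fun i => hl i (ε / 2 / E) (by positivity)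
  refine ⟨∑ i, n i, fun k hk => ?_⟩
  have h1 : u k - ∑ i, l i • b.vec i = ∑ i, (b.coord i (u k) - l i) • b.vec i := by
    simp only [sub_smul, Finset.sum_sub_distrib, b.sum_coord_smul]
  refine lt_of_le_of_lt (Real.iSup_le (fun s => ?_) (half_pos hε).le) (half_lt_self hε)
  have hsum : ∀ (t : Finset (Fin b.n)) (f : Fin b.n → S), (∀ i ∈ t, N.opNrm b s (f i) ≤ ε / 2) →
      N.opNrm b s (∑ i ∈ t, f i) ≤ ε / 2 := fun t f hf => by
    refine N.opNrm_le b (half_pos hε).le fun y => ?_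
    rw [Finset.sum_mul]
    refine Real.iSup_le (fun j => ?_) (mul_nonneg (half_pos hε).le (N.coordNrm_nonneg b s y))
    rw [map_sum]
    refine N.nrm_sum_le s _ _ (mul_nonneg (half_pos hε).le (N.coordNrm_nonneg b s y)) fun i hi => ?_
    exact (N.nrm_coord_le b s j _).trans ((N.coordNrm_mul_le_opNrm b s _ _).trans
      (mul_le_mul_of_nonneg_right (hf i hi) (N.coordNrm_nonneg b s y)))
  rw [h1]
  refine hsum _ _ fun i _ => (N.opNrm_smul_le b s _ _).trans ?_
  have h2 : N.nrm s (b.coord i (u k) - l i) ≤ ε / 2 / E :=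
    (N.nrm_le_norm s _).trans (hn i k ((Finset.single_le_sum (f := n) (fun _ _ => Nat.zero_le _)
      (Finset.mem_univ i)).trans hk)).le
  have h3 : N.opNrm b s (b.vec i) ≤ E := by
    refine (le_ciSup (N.bddAbove_opNrm b _) s).trans ?_
    have := Finset.single_le_sum (f := fun i => ⨆ s, N.opNrm b s (b.vec i))
      (fun i _ => Real.iSup_nonneg fun s => N.opNrm_nonneg b s (b.vec i)) (Finset.mem_univ i)
    linarith
  calc N.nrm s (b.coord i (u k) - l i) * N.opNrm b s (b.vec i) ≤ ε / 2 / E * E :=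
        mul_le_mul h2 h3 (N.opNrm_nonneg b s _) (by positivity)
    _ = ε / 2 := div_mul_cancel₀ _ hE1.ne'

variable [Algebra K S] [IsScalarTower K R S]

theorem abs_mul_coordNrm_smul (s : ι) {a a' : A} {c : K}
    (h : algebraMap A K a' * c = algebraMap A K a) (y : S) :
    V.abs s a' * N.coordNrm b s (c • y) = V.abs s a * N.coordNrm b s y := by
  rw [coordNrm, coordNrm, Real.mul_iSup_of_nonneg (NNReal.coe_nonneg _),
    Real.mul_iSup_of_nonneg (NNReal.coe_nonneg _)]
  congr 1
  ext i
  rw [LinearMap.map_smul_of_tower]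
  exact N.smul s a a' c _ h

/-- The Banach algebra structure on a finite projective algebra that is given by the operator
norms. -/
noncomputable def ofDualBasis : BanachAlgebra V K S where
  nrm := N.opNrm b
  nonneg := N.opNrm_nonneg b
  add_le := N.opNrm_add_le b
  smul s a a' c x h := by
    rw [opNrm, opNrm, Real.mul_iSup_of_nonneg (NNReal.coe_nonneg _),
      Real.mul_iSup_of_nonneg (NNReal.coe_nonneg _)]
    congr 1
    ext y
    rw [smul_mul_assoc, ← mul_div_assoc, N.abs_mul_coordNrm_smul b s h, mul_div_assoc]
  mul_le := N.opNrm_mul_le b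
  one s := by
    rintro ⟨x, hx⟩
    by_cases h : ∃ y, N.coordNrm b s y ≠ 0
    · exact N.opNrm_one b h.choose_spec
    · push Not at h
      exact absurd (by simp [opNrm, h]) hx
  bddAbove := N.bddAbove_opNrm b
  separated x hx := by
    rw [← b.sum_coord_smul x]
    refine Finset.sum_eq_zero fun i _ => ?_
    rw [N.separated (b.coord i x) fun s => le_antisymm ?_ (N.nonneg s _), zero_smul]
    refine (N.nrm_coord_le_opNrm b s i x).trans ?_
    rw [hx, zero_mul]
  complete := N.opNrm_complete b

theorem norm_ofDualBasis_smul_le (r : R) (x : S) :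
    (N.ofDualBasis b).norm (r • x) ≤ N.norm r * (N.ofDualBasis b).norm x :=
  Real.iSup_le (fun s => (N.opNrm_smul_le b s r x).trans (mul_le_mul (N.nrm_le_norm s r)
    ((N.ofDualBasis b).nrm_le_norm s x) (N.opNrm_nonneg b s x) (N.norm_nonneg r)))
    (mul_nonneg (N.norm_nonneg r) ((N.ofDualBasis b).norm_nonneg x))

/-- Linear forms on `S` are bounded. -/
theorem exists_norm_apply_le (g : S →ₗ[R] R) :
    ∃ C, 0 ≤ C ∧ ∀ x, N.norm (g x) ≤ C * (N.ofDualBasis b).norm x := by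
  have h0 : 0 ≤ ∑ j, N.norm (b.coord j 1) := Finset.sum_nonneg fun _ _ => N.norm_nonneg _
  have h1 : 0 ≤ ∑ i, N.norm (g (b.vec i)) := Finset.sum_nonneg fun _ _ => N.norm_nonneg _
  refine ⟨(∑ j, N.norm (b.coord j 1)) * ∑ i, N.norm (g (b.vec i)), mul_nonneg h0 h1, fun x => ?_⟩
  have hx := (N.ofDualBasis b).norm_nonneg x
  conv_lhs => rw [← b.sum_coord_smul x, map_sum]
  refine N.norm_sum_le _ _ (mul_nonneg (mul_nonneg h0 h1) hx) fun i _ => ?_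
  rw [map_smul, smul_eq_mul, mul_right_comm]
  refine (N.norm_mul_le _ _).trans (mul_le_mul (N.norm_coord_le_iSup_opNrm b i x)
    (Finset.single_le_sum (f := fun i => N.norm (g (b.vec i))) (fun _ _ => N.norm_nonneg _)
      (Finset.mem_univ i)) (N.norm_nonneg _) (mul_nonneg h0 hx))

theorem nrm_ofDualBasis_one (h : Function.Injective (algebraMap R S)) {s : ι}
    (hs : N.nrm s 1 = 1) : (N.ofDualBasis b).nrm s 1 = 1 := by
  by_cases hy : ∃ y, N.coordNrm b s y ≠ 0
  · exact N.opNrm_one b hy.choose_spec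
  · -- otherwise the kernel of `‖·‖_s` on `R` contains all coordinates, hence also `1`
    push Not at hy
    have h1 : (1 : R) ∈ Ideal.span {r | ∃ i y, b.coord i y = r} := by
      rw [b.span_coord_eq_top h]; trivial
    have h2 : ∀ r ∈ Ideal.span {r | ∃ i y, b.coord i y = r}, N.nrm s r ≤ 0 := fun r hr => by
      induction hr using Submodule.span_induction with
      | mem r hr =>
        obtain ⟨i, y, rfl⟩ := hr
        exact (N.nrm_coord_le b s i y).trans (hy y).le
      | zero => exact (N.nrm_zero s).le
      | add x y _ _ hx hy => exact (N.add_le s x y).trans (max_le hx hy)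
      | smul a x _ hx =>
        exact (N.mul_le s a x).trans (mul_nonpos_of_nonneg_of_nonpos (N.nonneg s a) hx)
    linarith [h2 1 h1]

/-- The norms make `S` a topological `R`-module with continuous coordinates; only the module topology
has this property. -/
theorem topology_ofDualBasis :
    (N.ofDualBasis b).topology = @moduleTopology R N.topology S _ _ := by
  let iR : NormedCommRing R :=
    { N.addGroupNorm.toNormedAddCommGroup, (inferInstance : CommRing R) with
      norm_mul_le := N.norm_mul_le }
  -- `X` is kept apart from `S`, which carries two topologies
  have key : ∀ (X : Type _) [TopologicalSpace X] (f : Fin b.n → X → R),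
      (∀ i, Continuous (f i)) →
      @Continuous X S _ (moduleTopology R S) fun x => ∑ i, f i x • b.vec i := by
    intro X _ f hf
    let _ : TopologicalSpace S := moduleTopology R S
    have := ModuleTopology.continuousSMul R S
    have := ModuleTopology.continuousAdd R S
    exact continuous_finsetSum _ fun i _ => (hf i).smul continuous_const
  let iS : NormedAddCommGroup S := (N.ofDualBasis b).addGroupNorm.toNormedAddCommGroup
  change (iS.toUniformSpace.toTopologicalSpace : TopologicalSpace S) = moduleTopology R S
  refine le_antisymm ?_ ?_
  · rw [← continuous_id_iff_le]
    have h1 : (id : S → S) = fun x => ∑ i, b.coord i x • b.vec i :=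
      funext fun x => (b.sum_coord_smul x).symm
    rw [h1]
    refine key S (fun i => b.coord i) fun i => ?_
    obtain ⟨C, -, hC⟩ := N.exists_norm_apply_le b (b.coord i)
    exact AddMonoidHomClass.continuous_of_bound (b.coord i) C hC
  · have : IsBoundedSMul R S := IsBoundedSMul.of_norm_smul_le (N.norm_ofDualBasis_smul_le b)
    exact moduleTopology_le R S

end BanachAlgebra

/-! ### Almost purity -/

namespace BanachAlgebra

universe u w t

section General

variable {A : Type u} {ι : Type w} [CommRing A] {V : AbsFamily A ι} {K : Type t} {R S : Type v}
  [CommRing K] [CommRing R] [CommRing S] [Algebra A K] [Algebra K R] [Algebra A R]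
  [IsScalarTower A K R] [Algebra K S] [Algebra A S] [IsScalarTower A K S] [Algebra R S]
  [IsScalarTower K R S] (N : BanachAlgebra V K R) (b : DualBasis R S)

theorem algebraMap_mem_powerBounded {x : R} (hx : x ∈ N.powerBounded) :
    algebraMap R S x ∈ (N.ofDualBasis b).powerBounded := by
  obtain ⟨c, hc⟩ := hx
  refine ⟨c * (N.ofDualBasis b).norm 1, fun n => ?_⟩
  rw [← map_pow, Algebra.algebraMap_eq_smul_one]
  exact (N.norm_ofDualBasis_smul_le b _ _).trans
    (mul_le_mul_of_nonneg_right (hc n) ((N.ofDualBasis b).norm_nonneg 1))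

section Perfectoid

variable {p : ℕ} [hp : Fact p.Prime] {ϖ : A} {r : ℝ} (E : EtaleDatum R S)

/-- The trace commutes with Frobenius, so the `p ^ k`-th powers of the trace of a power-bounded
element are bounded. -/
theorem τ_mem_powerBounded (h : IsPerfectBase p V ϖ r) (hu : IsUnit (algebraMap A R ϖ))
    (hN : N.IsPerfectoid p ϖ) {x : S} (hx : x ∈ (N.ofDualBasis b).powerBounded) :
    E.τ x ∈ N.powerBounded := by
  have := N.isReduced h hu hN.bounded
  obtain ⟨c, hc⟩ := hx
  obtain ⟨C, hC0, hC⟩ := N.exists_norm_apply_le b E.τ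
  refine N.mem_powerBounded_of_pow_prime_pow hp.1 h hN.bounded (C := C * c) fun k => ?_
  rw [← E.τ_pow (natCast_eq_zero_of_algebra A h.natCast_eq_zero) (N.exists_pow_eq h hu hN)]
  exact (hC _).trans (mul_le_mul_of_nonneg_left (hc _) hC0)

/-- A power-bounded `x` is recovered from the traces `τ (bᵢ x)`, which lie in a bounded set. -/
theorem bounded_ofDualBasis (h : IsPerfectBase p V ϖ r) (hu : IsUnit (algebraMap A R ϖ))
    (hN : N.IsPerfectoid p ϖ) (E : EtaleDatum R S) :
    ∃ c : ℝ, ∀ x ∈ (N.ofDualBasis b).powerBounded, (N.ofDualBasis b).norm x ≤ c := by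
  have : IsScalarTower A R S := IsScalarTower.of_algebraMap_eq fun a => by
    rw [IsScalarTower.algebraMap_apply A K R, ← IsScalarTower.algebraMap_apply K R S,
      ← IsScalarTower.algebraMap_apply A K S]
  set N' := N.ofDualBasis b
  obtain ⟨c, hc⟩ := hN.bounded
  have hc0 : 0 ≤ c := (N.norm_nonneg 0).trans (hc 0 N.powerBounded.zero_mem)
  obtain ⟨m, a, d, he⟩ := TensorProduct.exists_sum_tmul_eq E.e
  obtain ⟨n, hn⟩ := N'.exists_pow_mul_mem_fin h d
  have ha0 : 0 ≤ ∑ i, N'.norm (a i) := Finset.sum_nonneg fun _ _ => N'.norm_nonneg _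
  have he' : (algebraMap A R ϖ ^ n) • E.e =
      ∑ i, a i ⊗ₜ[R] (algebraMap A S ϖ ^ n * d i) := by
    rw [he, Finset.smul_sum]
    refine Finset.sum_congr rfl fun i _ => ?_
    rw [← TensorProduct.tmul_smul, Algebra.smul_def, map_pow, ← IsScalarTower.algebraMap_apply]
  refine ⟨(r ^ n)⁻¹ * (c * ∑ i, N'.norm (a i)), fun x hx => ?_⟩
  rw [← div_eq_inv_mul, le_div_iff₀ (pow_pos h.pos n), mul_comm,
    ← N'.norm_map_pow_mul h.pos.le h.abs_eq, IsScalarTower.algebraMap_apply A R S, ← map_pow,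
    ← Algebra.smul_def, ← E.sum_τ_smul he']
  refine N'.norm_sum_le _ _ (mul_nonneg hc0 ha0) fun i _ => ?_
  refine (N.norm_ofDualBasis_smul_le b _ _).trans (mul_le_mul ?_ ?_ (N'.norm_nonneg _) hc0)
  · exact hc _ (N.τ_mem_powerBounded b E h hu hN (N'.powerBounded.mul_mem (hn i) hx))
  · exact Finset.single_le_sum (f := fun i => N'.norm (a i)) (fun _ _ => N'.norm_nonneg _)
      (Finset.mem_univ i)

theorem isPerfectoid_ofDualBasis (h : IsPerfectBase p V ϖ r) (hu : IsUnit (algebraMap A R ϖ))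
    (hN : N.IsPerfectoid p ϖ) (E : EtaleDatum R S) : (N.ofDualBasis b).IsPerfectoid p ϖ where
  isOpen := (N.ofDualBasis b).isOpen_powerBounded
  bounded := N.bounded_ofDualBasis b h hu hN E
  frobenius x := by
    obtain ⟨y, hy⟩ := E.exists_pow_eq (natCast_eq_zero_of_algebra A h.natCast_eq_zero)
      (N.exists_pow_eq h hu hN) x
    refine ⟨⟨y, (N.ofDualBasis b).mem_powerBounded_of_pow hp.1.ne_zero (hy ▸ x.2)⟩, 0, ?_⟩
    rw [mul_zero, sub_eq_zero]
    exact Subtype.ext hy.symm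

/-- All `ε e` with `ε ∈ 𝔥` are sums of `m` tensors of power-bounded elements. If `ϖ ^ n e` is such a
sum, so is `ϖ ^ (n / p ^ l) e` for all `l`, as `e` is invariant under the inverse of Frobenius. -/
theorem exists_smul_e_eq_sum (h : IsPerfectBase p V ϖ r) (hu : IsUnit (algebraMap A R ϖ))
    (hN : N.IsPerfectoid p ϖ) [Algebra.Etale R S] [Module.Finite R S] :
    ∃ m, ∀ ε ∈ V.𝔥, ∃ x y : Fin m → (N.ofDualBasis b).powerBounded,
      algebraMap A R ε • E.e = ∑ i, (x i : S) ⊗ₜ[R] (y i : S) := by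
  have : IsScalarTower A R S := IsScalarTower.of_algebraMap_eq fun a => by
    rw [IsScalarTower.algebraMap_apply A K R, ← IsScalarTower.algebraMap_apply K R S,
      ← IsScalarTower.algebraMap_apply A K S]
  have := N.isReduced h hu hN.bounded
  have hR0 : (p : R) = 0 := natCast_eq_zero_of_algebra A h.natCast_eq_zero
  set N' := N.ofDualBasis b
  obtain ⟨π, hπ0, hπ⟩ := h.exists_roots
  have hπ' : ∀ k, π k ^ p ^ k = ϖ := fun k => by simpa [hπ0] using hπ 0 k
  obtain ⟨m, a, d, he⟩ := TensorProduct.exists_sum_tmul_eq E.e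
  obtain ⟨n₁, hn₁⟩ := N'.exists_pow_mul_mem_fin h a
  obtain ⟨n₂, hn₂⟩ := N'.exists_pow_mul_mem_fin h d
  refine ⟨m, fun ε hε => ?_⟩
  obtain ⟨k, η, hη, hεη⟩ := N.exists_eq_root_mul hp.1 h hu hπ' hε
  -- `l` is so large that `(n₁ + n₂) / p ^ l ≤ 1 / p ^ k`
  set q := n₁ + n₂ with hq
  obtain ⟨l, hl⟩ : ∃ l, l = k + q := ⟨_, rfl⟩
  obtain ⟨j, hj⟩ := Nat.exists_eq_add_of_le (Nat.lt_pow_self hp.1.one_lt (n := q)).le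
  have hS := exists_pow_prime_pow_eq (E.exists_pow_eq hR0 (N.exists_pow_eq h hu hN)) l
  choose x hx using fun i => hS (a i)
  choose y hy using fun i => hS (d i)
  have hxy : E.e = ∑ i, x i ⊗ₜ[R] y i := by
    refine E.e_eq_sum_of_pow hR0 (n := l) ?_
    simpa [hx, hy] using he
  have hmem : ∀ (n : ℕ) (z : S), algebraMap A S ϖ ^ n * z ^ p ^ l ∈ N'.powerBounded →
      algebraMap A S (π l) ^ n * z ∈ N'.powerBounded := fun n z hz => by
    refine N'.mem_powerBounded_of_pow (pow_ne_zero l hp.1.ne_zero) ?_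
    rwa [mul_pow, ← pow_mul, mul_comm n, pow_mul, ← map_pow, hπ']
  have hηS : algebraMap A S (π l) ^ j * algebraMap R S η ∈ N'.powerBounded :=
    N'.powerBounded.mul_mem (N'.powerBounded.pow_mem (N'.powerBounded.algebraMap_mem _) j)
      (N.algebraMap_mem_powerBounded b hη)
  refine ⟨fun i => ⟨_, N'.powerBounded.mul_mem hηS (hmem n₁ (x i) (by rw [hx]; exact hn₁ i))⟩,
    fun i => ⟨_, hmem n₂ (y i) (by rw [hy]; exact hn₂ i)⟩, ?_⟩
  rw [hxy, Finset.smul_sum]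
  refine Finset.sum_congr rfl fun i _ => ?_
  have h1 : algebraMap A R ε = (algebraMap A R (π l) ^ j * η * algebraMap A R (π l) ^ n₁) *
      algebraMap A R (π l) ^ n₂ := by
    rw [hεη, ← hπ k q, ← hl, hj, hq, map_pow]
    ring
  have h2 : ∀ (c : R) (z : S), c • z = algebraMap R S c * z := fun c z => Algebra.smul_def c z
  rw [h1, mul_smul,
    ← TensorProduct.tmul_smul, TensorProduct.smul_tmul', h2, h2]
  simp only [map_mul, map_pow, ← IsScalarTower.algebraMap_apply A R S, mul_assoc]

theorem isAlmostFiniteEtaleOver_ofDualBasis (h : IsPerfectBase p V ϖ r)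
    (hu : IsUnit (algebraMap A R ϖ)) (hN : N.IsPerfectoid p ϖ) [Algebra.Etale R S]
    [Module.Finite R S] : (N.ofDualBasis b).IsAlmostFiniteEtaleOver N := by
  have hmap : ∀ x ∈ N.powerBounded, algebraMap R S x ∈ (N.ofDualBasis b).powerBounded :=
    fun x hx => N.algebraMap_mem_powerBounded b hx
  obtain ⟨E⟩ := nonempty_etaleDatum (R := R) (S := S)
  set N' := N.ofDualBasis b
  refine ⟨hmap, ?_⟩
  let _ : Algebra N.powerBounded N'.powerBounded := (N.powerBoundedMap N' hmap).toRingHom.toAlgebra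
  have : IsScalarTower A N.powerBounded N'.powerBounded :=
    IsScalarTower.of_algebraMap_eq fun a => ((N.powerBoundedMap N' hmap).commutes a).symm
  have hT : IsScalarTower N.powerBounded N'.powerBounded S :=
    IsScalarTower.of_algebraMap_eq fun a => rfl
  obtain ⟨m, hm⟩ := N.exists_smul_e_eq_sum b E h hu hN
  obtain ⟨π, hπ0, hπ⟩ := h.exists_roots
  have hπ' : ∀ k, π k ^ p ^ k = ϖ := fun k => by simpa [hπ0] using hπ 0 k
  let M : AlmostModel V.𝔥 N.powerBounded N'.powerBounded E m :=
    { injective := Subtype.val_injective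
      trace :=
        { toFun := fun x => ⟨E.τ x, N.τ_mem_powerBounded b E h hu hN x.2⟩
          map_add' := fun x y => Subtype.ext (E.τ.map_add (x : S) (y : S))
          map_smul' := fun c x => Subtype.ext (by
            have h1 : ((c • x : N'.powerBounded) : S) = (c : R) • (x : S) := by
              rw [Algebra.smul_def, Algebra.smul_def]; rfl
            change E.τ ((c • x : N'.powerBounded) : S) = (c : R) * E.τ (x : S)
            rw [h1, map_smul, smul_eq_mul]) }
      algebraMap_trace := fun x => rfl
      exists_sum := hm }
  have hex : ExhaustingSequence V.𝔥 N.powerBounded R π :=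
    { mem := fun k => by
        have h1 : r ^ (((p ^ k : ℕ) : ℝ)⁻¹) < 1 := Real.rpow_lt_one h.pos.le h.lt_one
          (inv_pos.mpr (Nat.cast_pos.mpr (pow_pos hp.1.pos k)))
        exact lt_of_le_of_lt (Real.iSup_le (fun s => (h.abs_root hp.1 (hπ' k) s).le)
          (Real.rpow_nonneg h.pos.le _)) h1
      dvd := fun {k l} hkl => by
        obtain ⟨j, rfl⟩ := Nat.exists_eq_add_of_le hkl
        rw [← hπ k j]
        exact dvd_pow_self _ (pow_ne_zero j hp.1.ne_zero)
      isUnit := fun k => by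
        change IsUnit (algebraMap A R (π k))
        rw [← hπ' k, map_pow] at hu
        exact (isUnit_pow_iff (pow_ne_zero k hp.1.ne_zero)).mp hu
      exists_eq_sq_mul := fun ε hε => by
        obtain ⟨k, η, hη, hεη⟩ := N.exists_eq_root_mul hp.1 h hu hπ' hε
        obtain ⟨j, hj⟩ := Nat.exists_eq_add_of_le hp.1.two_le
        refine ⟨k + 1, algebraMap A N.powerBounded (π (k + 1)) ^ j * ⟨η, hη⟩, Subtype.ext ?_⟩
        change algebraMap A R ε = algebraMap A R (π (k + 1)) ^ 2 *
          (algebraMap A R (π (k + 1)) ^ j * η)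
        have h1 := hπ k 1
        rw [pow_one] at h1
        rw [hεη, ← h1, map_pow, ← mul_assoc, ← pow_add, ← hj] }
  exact ⟨M.almostFiniteEtale hex, M.isAlmostSummand.uniformlyFiniteProjective⟩

end Perfectoid

end General

end BanachAlgebra

end DeltaPerfectoid

theorem mainTheorem13 (p : ℕ) [Fact p.Prime]
    (K₀ : Type*) [NontriviallyNormedField K₀] [IsUltrametricDist K₀] [CompleteSpace K₀]
    [DeltaPerfectoid.IsPAdicField p K₀]
    (Δ : Type*) [Fintype Δ] [Nonempty Δ]
    (D : DeltaPerfectoid.PerfectoidFamily p K₀ (DeltaPerfectoid.CompletedClosure K₀) Δ)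
    (ϖ : D.Tilt) (hϖ : D.absFamily.IsPseudoUniformizer ϖ)
    (K : Type*) [CommRing K] [Algebra D.Tilt K] (hK : DeltaPerfectoid.IsRingOfFractions ϖ K)
    (R S : Type v) [CommRing R] [CommRing S]
    [Algebra K R] [Algebra D.Tilt R] [IsScalarTower D.Tilt K R]
    [Algebra K S] [Algebra D.Tilt S] [IsScalarTower D.Tilt K S]
    [Algebra R S] [IsScalarTower K R S]
    (N : DeltaPerfectoid.BanachAlgebra D.absFamily K R) (hR : N.IsPerfectoid p ϖ)
    [Algebra.Etale R S] [Module.Finite R S] :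
    ∃ N' : DeltaPerfectoid.BanachAlgebra D.absFamily K S,
      N'.topology = @moduleTopology R N.topology S _ _ ∧
      (Function.Injective (algebraMap R S) → (∀ s, N.nrm s 1 = 1) → ∀ s, N'.nrm s 1 = 1) ∧
      N'.IsPerfectoid p ϖ ∧
      N'.IsAlmostFiniteEtaleOver N := by
  obtain ⟨-, r, hr0, hr1, hr⟩ := hϖ
  have hbase : DeltaPerfectoid.IsPerfectBase p D.absFamily ϖ r :=
    { natCast_eq_zero := CharP.cast_eq_zero D.Tilt p
      exists_pow_eq := fun x => (frobeniusEquiv D.Tilt p).surjective x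
      pos := hr0
      lt_one := hr1
      abs_eq := hr }
  have hu : IsUnit (algebraMap D.Tilt R ϖ) := by
    obtain ⟨M, -, hM, hloc⟩ := hK
    rw [IsScalarTower.algebraMap_apply D.Tilt K R]
    exact (IsLocalization.map_units K (⟨ϖ, hM⟩ : M)).map (algebraMap K R)
  obtain ⟨b⟩ := DeltaPerfectoid.nonempty_dualBasis (R := R) (S := S)
  obtain ⟨E⟩ := DeltaPerfectoid.nonempty_etaleDatum (R := R) (S := S)
  exact ⟨N.ofDualBasis b, N.topology_ofDualBasis b,
    fun hinj h1 s => N.nrm_ofDualBasis_one b hinj (h1 s),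
    N.isPerfectoid_ofDualBasis b hbase hu hR E,
    N.isAlmostFiniteEtaleOver_ofDualBasis b hbase hu hR⟩
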